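/- \textbf{Model.} A network is a connected simple graph $G$ on $n$ nodes with pairwise distinct identifiers below $n^{a}$ ($a$ a constant). Computation proceeds in synchronous rounds; in each round every node may send a (possibly different) message to each of its neighbours. In the CONGEST model every message has $O(\log n)$ bits. Local computation is unrestricted; initially a node knows $n$, a parameter $k$, its own identifier, its neighbours' identifiers and, in a randomized algorithm, its own independent uniform random bits. An algorithm \emph{solves $k$-MaxM} on $G$ if, when it terminates, the following holds: if $G$ has a matching with at least $k$ edges, then the nodes output such a matching (every node knows which of its incident edges are in the matching, and both endpoints of an edge agree); otherwise all nodes report that no such matching exists. \textbf{Theorem.} For every constant $a$ there is a constant $B$, bounding the message size by $B\log_2 n$ bits in all networks with identifiers below $n^{a}$, such that the following hold. (i) There is a deterministic CONGEST algorithm that solves $k$-MaxM in $O(k^2)$ rounds, for every $n$ and every $k\ge 0$. (ii) For every constant integer $c\ge 0$ there is a randomized CONGEST algorithm that, for all $n\ge 2$ and $k\ge 1$, always terminates within $O\!\left(k+\frac{k^2\log k}{\log n}\right)$ rounds and solves $k$-MaxM with probability at least $1-k^{-c}$. The constants in the $O(\cdot)$ of the numbers of rounds depend only on $a$ in (i),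 and only on $a$ and $c$ in (ii). -/

import Mathlib

/-- A communication network with `n` nodes: a connected simple graph whose nodes carry pairwise
distinct identifiers of at most `a * log₂ n` bits. -/
structure Network (a n : ℕ) where
  graph : SimpleGraph (Fin n)
  connected : graph.Connected
  ident : Fin n → ℕ
  ident_injective : Function.Injective ident
  ident_lt : ∀ v, ident v < n ^ a

/-- A synchronous message-passing algorithm for edge-set problems with an integer parameter `k`.
All nodes run the same code, with unbounded local computation, and know `n` and `k`. -/
structure DistAlgorithm where
  /-- Local memory contents of a node. -/
  State : Type
  /-- Number of private random bits of each node, as a function of `n` and `k`. -/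
  coins : ℕ → ℕ → ℕ
  /-- Number of rounds after which all nodes terminate, as a function of `n` and `k`. -/
  rounds : ℕ → ℕ → ℕ
  /-- Initial state, from `n`, `k`, the own identifier, the set of identifiers of the neighbours
  and the private random bits. -/
  init : (n k : ℕ) → ℕ → Set ℕ → (Fin (coins n k) → Bool) → State
  /-- The bit string sent to the neighbour with the given identifier
  (the empty string means silence). -/
  send : State → ℕ → List Bool
  /-- New state, from the old one and the set of all pairs
  (identifier of a neighbour, message received from that neighbour). -/
  recv : State → Set (ℕ × List Bool) → State
  /-- Final output: `none` is the report that no solution of size `k` exists, and `some S` says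
  that the solution edges at this node are those to the neighbours with an identifier in `S`. -/
  output : State → Option (Set ℕ)

namespace DistAlgorithm

/-- The outcomes of all private random bits in a network of `n` nodes. -/
abbrev Coins (A : DistAlgorithm) (n k : ℕ) : Type := Fin n → Fin (A.coins n k) → Bool

/-- The state of each node after `t` rounds. In a round, every node sends one message to each of
its neighbours, receives the messages of its neighbours and updates its state. -/
def stateAfter (A : DistAlgorithm) {a n : ℕ} (N : Network a n) (k : ℕ) (ω : A.Coins n k) :
    ℕ → Fin n → A.State
  | 0, v => A.init n k (N.ident v) (N.ident '' N.graph.neighborSet v) (ω v)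
  | t + 1, v => A.recv (A.stateAfter N k ω t v)
      {p | ∃ u, N.graph.Adj v u ∧
        p = (N.ident u, A.send (A.stateAfter N k ω t u) (N.ident v))}

/-- The outputs of the nodes when the algorithm terminates. -/
def result (A : DistAlgorithm) {a n : ℕ} (N : Network a n) (k : ℕ) (ω : A.Coins n k) :
    Fin n → Option (Set ℕ) :=
  fun v => A.output (A.stateAfter N k ω (A.rounds n k) v)

/-- No random bits are used. -/
def IsDeterministic (A : DistAlgorithm) : Prop := ∀ n k, A.coins n k = 0

/-- All messages ever sent in networks with identifiers below `n ^ a` have at most `B * log₂ n`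
bits. -/
def IsCongest (A : DistAlgorithm) (a : ℕ) (B : ℝ) : Prop :=
  ∀ (n : ℕ) (N : Network a n) (k : ℕ) (ω : A.Coins n k) (t : ℕ), t < A.rounds n k →
    ∀ u v, N.graph.Adj u v →
      ((A.send (A.stateAfter N k ω t u) (N.ident v)).length : ℝ) ≤ B * Real.logb 2 n

/-- Probability of an event when all private random bits are independent and uniform. -/
noncomputable def prob (A : DistAlgorithm) (n k : ℕ) (E : Set (A.Coins n k)) : ℝ :=
  (E.ncard : ℝ) / (Nat.card (A.Coins n k) : ℝ)

end DistAlgorithm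

/-- `M` is a matching with at least `k` edges. -/
def IsMatchingOfSize {V : Type} {G : SimpleGraph V} (k : ℕ) (M : G.Subgraph) : Prop :=
  M.IsMatching ∧ k ≤ M.edgeSet.ncard

/-- `out` is a correct output for the maximum matching problem with parameter `k`: if a matching
with at least `k` edges exists, then the nodes consistently output such a matching, each node
naming its own matching edges; otherwise all nodes report that there is none. -/
def Network.IsKMaxMOutput {a n : ℕ} (N : Network a n) (k : ℕ) (out : Fin n → Option (Set ℕ)) :
    Prop :=
  ((∃ M : N.graph.Subgraph, IsMatchingOfSize k M) →
    ∃ M : N.graph.Subgraph, IsMatchingOfSize k M ∧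
      ∀ v, out v = some (N.ident '' M.neighborSet v)) ∧
  ((¬ ∃ M : N.graph.Subgraph, IsMatchingOfSize k M) → ∀ v, out v = none)

/-! Take `k` greedy steps: every free node points to its free neighbour of greatest identifier, and
mutual pointers become matching edges. A step adds an edge unless the matching is maximal, so in the
end at least `2 * k` nodes are matched, or the matched nodes are a vertex cover with fewer than `2 *
k` elements (`Network.greedy_large_or_maximal`). In the first case the greedy matching is an answer.
In the second, every edge of a matching has a greedily matched endpoint, and such an endpoint need
only announce `2 * k` distinct neighbours: an unlisted partner can be traded for a listed one that
is not in use (`exists_injective_exchange`).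

The nodes must tell the cases apart and, in the second, learn all lists. They gossip, each
forwarding one new item at a time. Pipelining makes the delay additive in the distance
(`Network.gossip_progress`), and a long shortest path meets a vertex cover often. As the initial
holders of items form a vertex cover, `6 * k` gossip steps teach every node `2 * k` items or all of
them (`Network.gossip_complete`). A node with `2 * k` items outputs its greedy partner; otherwise
all nodes hold the same items and select the same matching by a common rule.

Lists name nodes by labels, not identifiers. Correctness needs distinct labels only on at most `4 *
k` nodes fixed before the labels are drawn: the matched nodes and the endpoints of one matching of
size `k` (`Network.isKMaxMOutput_matchingOutput`). There are `O(k)` exchanges of items. With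
identifiers as labels an item fills `O(k)` messages, which gives (i). With random labels of `O(1 +
log k)` bits it fills `O(1 + k log k / log n)` messages, and a union bound over pairs of nodes gives
(ii). -/

/-! ### Local programs and the functions they compute -/

/-- A clocked local program with `b`-bit broadcasts: the node input has type `α`, the node output
type `β`. -/
structure LocalProgram (α β : Type) where
  State : Type
  init : α → State
  send : ℕ → State → List Bool
  recv : ℕ → State → Set (ℕ × List Bool) → State
  out : State → β

/-- What a node knows initially: its identifier, those of its neighbours, and its coins. -/
abbrev NodeInput (κ : ℕ) : Type := ℕ × Set ℕ × (Fin κ → Bool)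

/-- The states of all nodes after `t` rounds of a local program. -/
def LocalProgram.run {κ : ℕ} {β : Type} (P : LocalProgram (NodeInput κ) β) {a n : ℕ}
    (N : Network a n) (ω : Fin n → Fin κ → Bool) : ℕ → Fin n → P.State
  | 0, v => P.init (N.ident v, N.ident '' N.graph.neighborSet v, ω v)
  | t + 1, v => P.recv t (P.run N ω t v)
      {p | ∃ u, N.graph.Adj v u ∧ p = (N.ident u, P.send t (P.run N ω t u))}

/-- `y` is computed in `T` rounds of `b`-bit broadcasts. -/
def Computes {a n : ℕ} (κ b T : ℕ) {β : Type}
    (y : Network a n → (Fin n → Fin κ → Bool) → Fin n → β) : Prop :=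
  ∃ P : LocalProgram (NodeInput κ) β, ∀ N ω,
    (∀ t < T, ∀ v, (P.send t (P.run N ω t v)).length ≤ b) ∧
      ∀ v, P.out (P.run N ω T v) = y N ω v

/-- The identifier of a node as an element of a finite type. -/
def Network.vid {a n : ℕ} (N : Network a n) (v : Fin n) : Fin (n ^ a) :=
  ⟨N.ident v, N.ident_lt v⟩

theorem Network.vid_injective {a n : ℕ} (N : Network a n) : Function.Injective N.vid :=
  fun _ _ h => N.ident_injective (congrArg Fin.val h)

/-- The identified messages that `v` receives if every node `u` broadcasts `s u`. -/
def Network.heard {a n : ℕ} (N : Network a n) {μ : Type} (s : Fin n → μ) (v : Fin n) :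
    Set (Fin (n ^ a) × μ) :=
  {p | ∃ u, N.graph.Adj v u ∧ p = (N.vid u, s u)}

theorem Network.mem_heard {a n : ℕ} (N : Network a n) {μ : Type} (s : Fin n → μ) (v u : Fin n)
    (c : μ) : (N.vid u, c) ∈ N.heard s v ↔ N.graph.Adj v u ∧ s u = c := by
  constructor
  · rintro ⟨w, hw, he⟩
    rw [Prod.mk.injEq] at he
    obtain rfl := N.vid_injective he.1
    exact ⟨hw, he.2.symm⟩
  · rintro ⟨h, rfl⟩
    exact ⟨u, h, rfl⟩

theorem exists_chunk_encoding {μ : Type} [Finite μ] {b q : ℕ} (h : Nat.card μ ≤ 2 ^ (b * q)) :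
    ∃ e : μ → Fin q → Fin b → Bool, Function.Injective e := by
  have := Fintype.ofFinite μ
  have hc : Fintype.card μ ≤ Fintype.card (Fin q → Fin b → Bool) := by
    simpa [Nat.card_eq_fintype_card, pow_mul] using h
  obtain ⟨e⟩ := Function.Embedding.nonempty_of_card_le hc
  exact ⟨e, e.injective⟩

/-- A long message is cut into `q` blocks of `b` bits, sent after the first `T` rounds. Blocks are
stored with their position and sender, and distinct identifiers let the receiver reassemble them.
Positivity of `q` matters: without any block, every pair would count as received. -/
theorem Computes.exchange {a n κ b T q : ℕ} {σ τ μ : Type} [Finite μ]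
    {y : Network a n → (Fin n → Fin κ → Bool) → Fin n → σ} (hy : Computes κ b T y)
    (hq : 0 < q) (hμ : Nat.card μ ≤ 2 ^ (b * q)) (m : σ → μ)
    (f : σ → Set (Fin (n ^ a) × μ) → τ) :
    Computes κ b (T + q) fun N ω v => f (y N ω v) (N.heard (fun u => m (y N ω u)) v) := by
  obtain ⟨P, hP⟩ := hy
  obtain ⟨e, he⟩ := exists_chunk_encoding hμ
  let chunk : ℕ → μ → List Bool := fun j c => if h : j < q then List.ofFn (e c ⟨j, h⟩) else []
  have chunk_inj : ∀ c d, (∀ j < q, chunk j c = chunk j d) → c = d := by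
    intro c d h
    apply he
    funext j
    have := h j j.2
    simp only [chunk, j.2, dif_pos] at this
    exact List.ofFn_injective this
  have chunk_len : ∀ j c, (chunk j c).length ≤ b := by
    intro j c
    simp only [chunk]
    split_ifs <;> simp
  let Q : LocalProgram (NodeInput κ) τ :=
    { State := P.State × Set (ℕ × ℕ × List Bool)
      init := fun x => (P.init x, ∅)
      send := fun t s => if t < T then P.send t s.1 else chunk (t - T) (m (P.out s.1))
      recv := fun t s R => if t < T then (P.recv t s.1 R, ∅)
        else (s.1, s.2 ∪ {p | p.1 = t - T ∧ p.2 ∈ R})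
      out := fun s => f (P.out s.1) {p | ∀ j < q, (j, (p.1 : ℕ), chunk j p.2) ∈ s.2} }
  have run_lt : ∀ (N : Network a n) ω, ∀ t ≤ T, ∀ v, Q.run N ω t v = (P.run N ω t v, ∅) := by
    intro N ω t
    induction t with
    | zero => intro _ v; rfl
    | succ t ih =>
      intro ht v
      have ht' : t < T := ht
      simp only [LocalProgram.run, ih ht'.le]
      simp [Q, ht']
  have run_ge : ∀ (N : Network a n) ω, ∀ j ≤ q, ∀ v, Q.run N ω (T + j) v = (P.run N ω T v,
      {p | p.1 < j ∧ ∃ u, N.graph.Adj v u ∧ p.2 = (N.ident u, chunk p.1 (m (y N ω u)))}) := by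
    intro N ω j
    induction j with
    | zero => intro _ v; simp [run_lt N ω T le_rfl]
    | succ j ih =>
      intro hj v
      have hj' : j < q := hj
      rw [← add_assoc, LocalProgram.run]
      simp only [ih hj'.le]
      simp only [Q, add_lt_iff_neg_left, not_lt_zero, if_false, Nat.add_sub_cancel_left,
        (hP N ω).2, Prod.mk.injEq, true_and]
      ext p
      simp only [Set.mem_union, Set.mem_ofPred_eq]
      constructor
      · rintro (⟨h1, h2⟩ | ⟨h1, h2⟩)
        · exact ⟨by omega, h2⟩
        · exact ⟨by omega, by rw [h1]; exact h2⟩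
      · rintro ⟨h1, h2⟩
        rcases Nat.lt_succ_iff_lt_or_eq.1 h1 with h | h
        · exact Or.inl ⟨h, h2⟩
        · exact Or.inr ⟨h, by rw [h] at h2; exact h2⟩
  refine ⟨Q, fun N ω => ⟨fun t ht v => ?_, fun v => ?_⟩⟩
  · by_cases h : t < T
    · rw [run_lt N ω t h.le]
      simpa [Q, h] using (hP N ω).1 t h v
    · simpa [Q, h] using chunk_len _ _
  · rw [run_ge N ω q le_rfl]
    simp only [Q, (hP N ω).2]
    congr 1
    ext ⟨i, c⟩
    simp only [Set.mem_ofPred_eq, Network.heard]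
    constructor
    · intro h
      obtain ⟨-, u, hu, hi⟩ := h 0 hq
      refine ⟨u, hu, ?_⟩
      rw [Prod.mk.injEq] at hi
      have hc : c = m (y N ω u) := by
        apply chunk_inj
        intro j hj
        obtain ⟨-, w, hw, hi'⟩ := h j hj
        rw [Prod.mk.injEq] at hi'
        have : w = u := N.ident_injective (by rw [← hi'.1, hi.1])
        rw [hi'.2, this]
      rw [hc, Prod.mk.injEq]
      exact ⟨Fin.ext hi.1, rfl⟩
    · rintro ⟨u, hu, hi⟩ j hj
      rw [Prod.mk.injEq] at hi
      exact ⟨hj, u, hu, by rw [hi.1, hi.2]; rfl⟩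

theorem Computes.map {a n κ b T : ℕ} {σ τ : Type}
    {y : Network a n → (Fin n → Fin κ → Bool) → Fin n → σ} (hy : Computes κ b T y) (f : σ → τ) :
    Computes κ b T fun N ω v => f (y N ω v) := by
  obtain ⟨P, hP⟩ := hy
  let Q : LocalProgram (NodeInput κ) τ := ⟨P.State, P.init, P.send, P.recv, fun s => f (P.out s)⟩
  have h : ∀ (N : Network a n) ω t, Q.run N ω t = P.run N ω t := by
    intro N ω t
    induction t with
    | zero => rfl
    | succ t ih => funext v; simp only [LocalProgram.run, ih]; rfl
  refine ⟨Q, fun N ω => ⟨fun t ht v => ?_, fun v => ?_⟩⟩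
  · rw [h]; exact (hP N ω).1 t ht v
  · rw [h]; exact congrArg f ((hP N ω).2 v)

theorem computes_input {a n κ b : ℕ} (hn : 0 < n) {σ : Type}
    (f : Fin (n ^ a) → (Fin κ → Bool) → σ) :
    Computes (a := a) (n := n) κ b 0 fun N ω v => f (N.vid v) (ω v) := by
  have h0 : 0 < n ^ a := pow_pos hn a
  refine ⟨⟨NodeInput κ, id, fun _ _ => [], fun _ s _ => s,
    -- The remainder only supplies the bound required by the type; it does not change the
    -- identifiers of a network.
    fun s => f ⟨s.1 % n ^ a, Nat.mod_lt _ h0⟩ s.2.2⟩, fun N ω => ⟨by simp, fun v => ?_⟩⟩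
  simp only [LocalProgram.run, id]
  congr 1
  exact Fin.ext (Nat.mod_eq_of_lt (N.ident_lt v))

/-- `G` maps global configurations to global configurations in `r` rounds of `b`-bit
broadcasts. -/
def Implements {a n : ℕ} (κ b r : ℕ) {σ τ : Type}
    (G : Network a n → (Fin n → σ) → Fin n → τ) : Prop :=
  ∀ (T : ℕ) (y : Network a n → (Fin n → Fin κ → Bool) → Fin n → σ),
    Computes κ b T y → Computes κ b (T + r) fun N ω => G N (y N ω)

theorem Implements.comp {a n κ b r s : ℕ} {σ τ υ : Type}
    {G : Network a n → (Fin n → σ) → Fin n → τ} {H : Network a n → (Fin n → τ) → Fin n → υ}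
    (hG : Implements κ b r G) (hH : Implements κ b s H) :
    Implements κ b (r + s) fun N x => H N (G N x) := by
  intro T y hy
  rw [← add_assoc]
  exact hH _ _ (hG _ _ hy)

theorem Implements.iterate {a n κ b r : ℕ} {σ : Type}
    {G : Network a n → (Fin n → σ) → Fin n → σ} (hG : Implements κ b r G) (t : ℕ) :
    Implements κ b (t * r) fun N x => (G N)^[t] x := by
  induction t with
  | zero => intro T y hy; simpa using hy
  | succ t ih =>
    rw [Nat.succ_mul]
    simp only [Function.iterate_succ_apply']
    exact ih.comp hG

/-! ### From local programs to algorithms -/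

/-- The algorithm that runs the local program `P n k` for `R n k` rounds. -/
def DistAlgorithm.ofPrograms (κ R : ℕ → ℕ → ℕ)
    (P : ∀ n k, LocalProgram (NodeInput (κ n k)) (Option (Set ℕ))) : DistAlgorithm where
  -- The model hands neither `n`, `k` nor the round number to `send` and `recv`, so the state
  -- carries them.
  State := Σ n k : ℕ, ℕ × (P n k).State
  coins := κ
  rounds := R
  init n k i S w := ⟨n, k, 0, (P n k).init (i, S, w)⟩
  send s _ := (P s.1 s.2.1).send s.2.2.1 s.2.2.2
  recv s M := ⟨s.1, s.2.1, s.2.2.1 + 1, (P s.1 s.2.1).recv s.2.2.1 s.2.2.2 M⟩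
  output s := (P s.1 s.2.1).out s.2.2.2

theorem DistAlgorithm.stateAfter_ofPrograms (κ R : ℕ → ℕ → ℕ)
    (P : ∀ n k, LocalProgram (NodeInput (κ n k)) (Option (Set ℕ))) {a n : ℕ} (N : Network a n)
    (k : ℕ) (ω : (DistAlgorithm.ofPrograms κ R P).Coins n k) (t : ℕ) (v : Fin n) :
    (DistAlgorithm.ofPrograms κ R P).stateAfter N k ω t v = ⟨n, k, t, (P n k).run N ω t v⟩ := by
  induction t generalizing v with
  | zero => rfl
  | succ t ih =>
    simp only [DistAlgorithm.stateAfter, ih]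
    rfl

theorem DistAlgorithm.exists_ofPrograms (a : ℕ) (κ R : ℕ → ℕ → ℕ)
    (y : ∀ n k, Network a n → (Fin n → Fin (κ n k) → Bool) → Fin n → Option (Set ℕ))
    (hy : ∀ n k, Computes (κ n k) (Nat.log 2 n + 1) (R n k) (y n k)) :
    ∃ P, (DistAlgorithm.ofPrograms κ R P).IsCongest a 2 ∧
      ∀ (n k : ℕ) (N : Network a n) (ω : Fin n → Fin (κ n k) → Bool),
        (DistAlgorithm.ofPrograms κ R P).result N k ω = y n k N ω := by
  choose P hP using hy
  refine ⟨P, ?_, ?_⟩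
  · intro n N k ω t ht u v huv
    have h := (hP n k N ω).1 t ht u
    rw [DistAlgorithm.stateAfter_ofPrograms]
    -- Messages travel along edges, so `n` is at least 2 and rounding up the logarithm costs at most
    -- a factor 2.
    have hn : 2 ≤ n := by
      have := huv.ne
      have := u.2
      have := v.2
      omega
    have h1 : (1 : ℝ) ≤ Real.logb 2 n := by
      rw [Real.le_logb_iff_rpow_le (by norm_num) (by positivity)]
      simpa using (by exact_mod_cast hn : (2 : ℝ) ≤ n)
    have h2 : ((Nat.log 2 n : ℕ) : ℝ) ≤ Real.logb 2 n := Real.natLog_le_logb n 2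
    have h3 : (((P n k).send t ((P n k).run N ω t u)).length : ℝ) ≤ (Nat.log 2 n : ℕ) + 1 := by
      exact_mod_cast h
    change (((P n k).send t ((P n k).run N ω t u)).length : ℝ) ≤ _
    linarith
  · intro n k N ω
    funext v
    exact (congrArg (DistAlgorithm.ofPrograms κ R P).output
      (DistAlgorithm.stateAfter_ofPrograms κ R P N k ω (R n k) v)).trans ((hP n k N ω).2 v)

/-! ### Greedy matching by mutual pointers -/

/-- The greatest element of a set, if it exists. -/
noncomputable def greatestOf {ι : Type} [Preorder ι] (S : Set ι) : Option ι :=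
  open Classical in if h : ∃ i, IsGreatest S i then some h.choose else none

theorem greatestOf_eq_some {ι : Type} [PartialOrder ι] {S : Set ι} {i : ι} :
    greatestOf S = some i ↔ IsGreatest S i := by
  unfold greatestOf
  split_ifs with h
  · rw [Option.some.injEq]
    exact ⟨fun e => e ▸ h.choose_spec, fun hi => h.choose_spec.unique hi⟩
  · exact ⟨fun e => by simp at e, fun hi => (h ⟨i, hi⟩).elim⟩

/-- A free node points to the greatest neighbour that it hears to be free. -/
noncomputable def localPointer {ι : Type} [Preorder ι] (m : Option ι) (S : Set (ι × Bool)) :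
    Option ι :=
  if m.isNone then greatestOf {i | (i, true) ∈ S} else none

/-- A node is matched to the node it points to if that node points back. -/
noncomputable def localMatch {ι : Type} (i : ι) (m p : Option ι) (S : Set (ι × Option ι)) :
    Option ι :=
  open Classical in match p with
  | none => m
  | some j => if (j, some i) ∈ S then some j else m

namespace Network

variable {a n : ℕ} (N : Network a n)

/-- The pointers of all nodes, for given partners `m`. -/
noncomputable def pointer (m : Fin n → Option (Fin (n ^ a))) (v : Fin n) :
    Option (Fin (n ^ a)) :=
  localPointer (m v) (N.heard (fun u => (m u).isNone) v)

/-- One iteration of the greedy matching. -/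
noncomputable def greedyStep (m : Fin n → Option (Fin (n ^ a))) (v : Fin n) :
    Option (Fin (n ^ a)) :=
  localMatch (N.vid v) (m v) (N.pointer m v) (N.heard (N.pointer m) v)

/-- The partners of all nodes form a matching. -/
def IsMating (m : Fin n → Option (Fin (n ^ a))) : Prop :=
  ∀ v p, m v = some p → ∃ u, N.vid u = p ∧ N.graph.Adj v u ∧ m u = some (N.vid v)

variable {N} {m : Fin n → Option (Fin (n ^ a))}

theorem eq_vid_of_pointer {v : Fin n} {p : Fin (n ^ a)} (h : N.pointer m v = some p) :
    ∃ u, N.vid u = p := by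
  unfold pointer localPointer at h
  split_ifs at h
  obtain ⟨⟨u, -, hu⟩, -⟩ := greatestOf_eq_some.1 h
  exact ⟨u, (congrArg Prod.fst hu).symm⟩

theorem pointer_eq_some {v u : Fin n} : N.pointer m v = some (N.vid u) ↔
    m v = none ∧ N.graph.Adj v u ∧ m u = none ∧
      ∀ w, N.graph.Adj v w → m w = none → N.vid w ≤ N.vid u := by
  unfold pointer localPointer
  split_ifs with h
  · rw [greatestOf_eq_some]
    have hv : m v = none := by simpa using h
    constructor
    · rintro ⟨h1, h2⟩
      have h1' := (N.mem_heard _ _ _ _).1 h1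
      refine ⟨hv, h1'.1, by simpa using h1'.2, fun w hw hm => h2 ?_⟩
      exact (N.mem_heard _ _ _ _).2 ⟨hw, by simp [hm]⟩
    · rintro ⟨-, h1, h2, h3⟩
      refine ⟨(N.mem_heard _ _ _ _).2 ⟨h1, by simp [h2]⟩, ?_⟩
      rintro _ ⟨w, hw, he⟩
      rw [Prod.mk.injEq] at he
      rw [he.1]
      exact h3 w hw (by simpa using he.2.symm)
  · simp only [false_iff, not_and]
    intro hv
    simp [hv] at h

theorem greedyStep_eq_some {v u : Fin n} : N.greedyStep m v = some (N.vid u) ↔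
    m v = some (N.vid u) ∨
      N.pointer m v = some (N.vid u) ∧ N.pointer m u = some (N.vid v) := by
  unfold greedyStep localMatch
  rcases hp : N.pointer m v with _ | p
  · simp
  · obtain ⟨w, rfl⟩ := eq_vid_of_pointer hp
    have h := pointer_eq_some.1 hp
    dsimp only
    split_ifs with h1 <;> rw [N.mem_heard] at h1
    · simp only [h.1, reduceCtorEq, false_or, Option.some.injEq, N.vid_injective.eq_iff]
      constructor
      · rintro rfl; exact ⟨rfl, h1.2⟩
      · exact fun e => e.1
    · simp only [h.1, reduceCtorEq, false_or, Option.some.injEq, N.vid_injective.eq_iff, false_iff]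
      rintro ⟨rfl, h2⟩
      exact h1 ⟨h.2.1, h2⟩

theorem eq_vid_of_greedyStep (hm : N.IsMating m) {v : Fin n} {p : Fin (n ^ a)}
    (h : N.greedyStep m v = some p) : ∃ u, N.vid u = p := by
  unfold greedyStep localMatch at h
  rcases hp : N.pointer m v with _ | q
  · rw [hp] at h
    obtain ⟨u, hu, -⟩ := hm v p h
    exact ⟨u, hu⟩
  · rw [hp] at h
    dsimp only at h
    split_ifs at h
    · rw [← Option.some.inj h]
      exact eq_vid_of_pointer hp
    · obtain ⟨u, hu, -⟩ := hm v p h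
      exact ⟨u, hu⟩

theorem IsMating.greedyStep (hm : N.IsMating m) : N.IsMating (N.greedyStep m) := by
  intro v p h
  obtain ⟨u, rfl⟩ := eq_vid_of_greedyStep hm h
  refine ⟨u, rfl, ?_⟩
  rcases greedyStep_eq_some.1 h with h1 | ⟨h1, h2⟩
  · obtain ⟨w, hw, hadj, hw'⟩ := hm v _ h1
    obtain rfl := N.vid_injective hw
    exact ⟨hadj, greedyStep_eq_some.2 (Or.inl hw')⟩
  · exact ⟨(pointer_eq_some.1 h1).2.1, greedyStep_eq_some.2 (Or.inr ⟨h2, h1⟩)⟩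

theorem isSome_greedyStep (hm : N.IsMating m) {v : Fin n} (h : (m v).isSome) :
    (N.greedyStep m v).isSome := by
  obtain ⟨p, hp⟩ := Option.isSome_iff_exists.1 h
  obtain ⟨u, rfl, -⟩ := hm v p hp
  rw [greedyStep_eq_some.2 (Or.inl hp)]
  rfl

/-- Let `w` have the greatest identifier among the free nodes with a free neighbour, and let `x` be
its greatest free neighbour. All free neighbours of `x` compete with `w` in the first maximum, so
`x` points back. -/
theorem exists_mutual_pointers {v u : Fin n} (huv : N.graph.Adj v u) (hv : m v = none)
    (hu : m u = none) :
    ∃ w x, N.graph.Adj w x ∧ m w = none ∧ m x = none ∧ N.pointer m w = some (N.vid x) ∧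
      N.pointer m x = some (N.vid w) := by
  classical
  let F : Finset (Fin n) := {w | m w = none ∧ ∃ u, N.graph.Adj w u ∧ m u = none}
  obtain ⟨w, hwF, hw⟩ := F.exists_max_image N.vid ⟨v, by simp [F]; exact ⟨hv, u, huv, hu⟩⟩
  have hwF' : m w = none ∧ ∃ u, N.graph.Adj w u ∧ m u = none := by simpa [F] using hwF
  let H : Finset (Fin n) := {x | N.graph.Adj w x ∧ m x = none}
  obtain ⟨y, hy⟩ := hwF'.2
  obtain ⟨x, hxH, hx⟩ := H.exists_max_image N.vid ⟨y, by simpa [H] using hy⟩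
  have hxH' : N.graph.Adj w x ∧ m x = none := by simpa [H] using hxH
  refine ⟨w, x, hxH'.1, hwF'.1, hxH'.2, pointer_eq_some.2 ⟨hwF'.1, hxH'.1, hxH'.2, ?_⟩,
    pointer_eq_some.2 ⟨hxH'.2, hxH'.1.symm, hwF'.1, ?_⟩⟩
  · intro z hz hz'
    exact hx z (by simp [H, hz, hz'])
  · intro z hz hz'
    exact hw z (by simp only [F, Finset.mem_filter_univ]; exact ⟨hz', x, hz.symm, hxH'.2⟩)

/-- The set of matched nodes. -/
def matched (m : Fin n → Option (Fin (n ^ a))) : Finset (Fin n) := {v | (m v).isSome}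

theorem mem_matched {v : Fin n} : v ∈ matched m ↔ (m v).isSome := by simp [matched]

variable (N) in
/-- The partners of all nodes after `t` iterations of the greedy matching. -/
noncomputable def greedy (t : ℕ) : Fin n → Option (Fin (n ^ a)) :=
  N.greedyStep^[t] fun _ => none

variable (N) in
theorem isMating_greedy (t : ℕ) : N.IsMating (N.greedy t) := by
  induction t with
  | zero => intro v p h; simp [greedy] at h
  | succ t ih =>
    unfold greedy at *
    rw [Function.iterate_succ_apply']
    exact ih.greedyStep

variable (N) in
theorem greedy_large_or_maximal (t : ℕ) : 2 * t ≤ (matched (N.greedy t)).card ∨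
    ∀ v u, N.graph.Adj v u → v ∈ matched (N.greedy t) ∨ u ∈ matched (N.greedy t) := by
  induction t with
  | zero => left; simp
  | succ t ih =>
    have hm := N.isMating_greedy t
    have hs : N.greedy (t + 1) = N.greedyStep (N.greedy t) := Function.iterate_succ_apply' _ _ _
    have hsub : matched (N.greedy t) ⊆ matched (N.greedy (t + 1)) := by
      intro v hv
      rw [mem_matched] at *
      rw [hs]
      exact isSome_greedyStep hm hv
    by_cases hmax : ∀ v u, N.graph.Adj v u → v ∈ matched (N.greedy t) ∨ u ∈ matched (N.greedy t)
    · right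
      intro v u h
      exact (hmax v u h).imp (fun h => hsub h) (fun h => hsub h)
    · left
      have ih := ih.resolve_right hmax
      push Not at hmax
      obtain ⟨v, u, huv, hv, hu⟩ := hmax
      simp only [mem_matched, Option.not_isSome_iff_eq_none] at hv hu
      obtain ⟨w, x, hwx, hw, hx, hpw, hpx⟩ := exists_mutual_pointers huv hv hu
      have hsub' : insert w (insert x (matched (N.greedy t))) ⊆ matched (N.greedy (t + 1)) := by
        intro y hy
        rcases Finset.mem_insert.1 hy with rfl | hy
        · rw [mem_matched, hs, greedyStep_eq_some.2 (Or.inr ⟨hpw, hpx⟩)]; rfl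
        rcases Finset.mem_insert.1 hy with rfl | hy
        · rw [mem_matched, hs, greedyStep_eq_some.2 (Or.inr ⟨hpx, hpw⟩)]; rfl
        exact hsub hy
      have hcard := Finset.card_le_card hsub'
      rw [Finset.card_insert_of_notMem, Finset.card_insert_of_notMem] at hcard
      · omega
      · simp [mem_matched, hx]
      · simp [mem_matched, hw, hwx.ne]

end Network

/-! ### Gossip -/

/-- Some item that is known but was not sent yet. -/
noncomputable def nextItem {I : Type} (s : Set I × Set I) : Option I :=
  open Classical in if h : (s.1 \ s.2).Nonempty then some h.some else none

/-- The new sets of known and of sent items, when the set of messages `M` is received. -/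
def updateItems {ι I : Type} (s : Set I × Set I) (M : Set (ι × Option I)) : Set I × Set I :=
  (s.1 ∪ {x | ∃ i, (i, some x) ∈ M}, s.2 ∪ {x | nextItem s = some x})

theorem nextItem_cases {I : Type} {s : Set I × Set I} (h : s.2 ⊆ s.1) :
    nextItem s = none ∧ s.2 = s.1 ∨ ∃ x, nextItem s = some x ∧ x ∈ s.1 ∧ x ∉ s.2 := by
  unfold nextItem
  split_ifs with hne
  · exact Or.inr ⟨_, rfl, hne.some_mem.1, hne.some_mem.2⟩
  · refine Or.inl ⟨rfl, h.antisymm ?_⟩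
    rwa [Set.not_nonempty_iff_eq_empty, Set.sdiff_eq_empty] at hne

theorem SimpleGraph.Connected.exists_adj_dist {V : Type*} {G : SimpleGraph V} (hG : G.Connected)
    {v w : V} {d : ℕ} (h : G.dist v w = d + 1) : ∃ x, G.Adj v x ∧ G.dist x w = d := by
  obtain ⟨p, hp⟩ := hG.exists_walk_length_eq_dist v w
  cases p with
  | nil => simp at h
  | @cons _ x _ hadj q =>
    refine ⟨x, hadj, ?_⟩
    have h1 : G.dist x w ≤ q.length := G.dist_le q
    have h2 : G.dist v w ≤ G.dist v x + G.dist x w := hG.dist_triangle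
    rw [SimpleGraph.dist_eq_one_iff_adj.2 hadj] at h2
    rw [SimpleGraph.Walk.length_cons] at hp
    omega

theorem SimpleGraph.Connected.exists_adj_layers {V : Type*} {G : SimpleGraph V}
    (hG : G.Connected) {v : V} (j e : ℕ) (w : V) (h : G.dist w v = j + 1 + e) :
    ∃ x y, G.Adj x y ∧ G.dist y v = j ∧ G.dist x v = j + 1 := by
  induction e generalizing w with
  | zero =>
    obtain ⟨x, hx, hd⟩ := hG.exists_adj_dist h
    exact ⟨w, x, hx, hd, h⟩
  | succ e ih =>
    obtain ⟨x, -, hd⟩ := hG.exists_adj_dist (d := j + 1 + e) h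
    exact ih x hd

/-- A vertex cover has many vertices close to a vertex of large eccentricity. -/
theorem SimpleGraph.Connected.le_ncard_cover_dist_lt {V : Type*} [Finite V] {G : SimpleGraph V}
    (hG : G.Connected) {Z : Set V} (hZ : ∀ x y, G.Adj x y → x ∈ Z ∨ y ∈ Z) {r : ℕ} {v w : V}
    (h : 2 * r ≤ G.dist w v) : r ≤ {z ∈ Z | G.dist z v ≤ 2 * r}.ncard := by
  -- A shortest path has an edge between the layers `2 * i` and `2 * i + 1`, and the cover contains
  -- one of its ends. Halving the distance recovers `i`, so these ends are distinct.
  have key : ∀ i : Fin r, ∃ z ∈ Z, G.dist z v / 2 = i := by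
    intro i
    have hi := i.2
    obtain ⟨x, y, hxy, hy, hx⟩ := hG.exists_adj_layers (v := v) (2 * i) (G.dist w v - (2 * i + 1)) w
      (by omega)
    rcases hZ x y hxy with hz | hz
    · exact ⟨x, hz, by omega⟩
    · exact ⟨y, hz, by omega⟩
  choose z hz hd using key
  have hinj : Function.Injective z := fun i j hij => Fin.ext (by rw [← hd i, ← hd j, hij])
  calc r = (Set.range z).ncard := by
        rw [← Set.image_univ, Set.ncard_image_of_injective _ hinj, Set.ncard_univ, Nat.card_fin]
    _ ≤ _ := Set.ncard_le_ncard (by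
        rintro _ ⟨i, rfl⟩
        have := hd i
        have := i.2
        exact ⟨hz i, by omega⟩)

namespace Network

variable {a n : ℕ} (N : Network a n) {I : Type}

/-- One round of gossip. -/
noncomputable def gossipStep (s : Fin n → Set I × Set I) (v : Fin n) : Set I × Set I :=
  updateItems (s v) (N.heard (fun u => nextItem (s u)) v)

/-- The known and the sent items of all nodes after `t` rounds of gossip. -/
noncomputable def gossip (K : Fin n → Set I) (t : ℕ) : Fin n → Set I × Set I :=
  N.gossipStep^[t] fun v => (K v, ∅)

variable {K : Fin n → Set I}

theorem gossip_succ (t : ℕ) (v : Fin n) : N.gossip K (t + 1) v =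
    updateItems (N.gossip K t v) (N.heard (fun u => nextItem (N.gossip K t u)) v) := by
  unfold gossip
  rw [Function.iterate_succ_apply']
  rfl

theorem mem_gossip_succ {t : ℕ} {v : Fin n} {x : I} : x ∈ (N.gossip K (t + 1) v).1 ↔
    x ∈ (N.gossip K t v).1 ∨ ∃ u, N.graph.Adj v u ∧ nextItem (N.gossip K t u) = some x := by
  rw [gossip_succ]
  refine or_congr_right ⟨?_, ?_⟩
  · rintro ⟨_, u, hu, he⟩
    exact ⟨u, hu, (congrArg Prod.snd he).symm⟩
  · rintro ⟨u, hu, he⟩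
    exact ⟨N.vid u, u, hu, Prod.ext rfl he.symm⟩

theorem mem_sent_succ {t : ℕ} {v : Fin n} {x : I} : x ∈ (N.gossip K (t + 1) v).2 ↔
    x ∈ (N.gossip K t v).2 ∨ nextItem (N.gossip K t v) = some x := by
  rw [gossip_succ]; rfl

theorem sent_subset_gossip (t : ℕ) (v : Fin n) : (N.gossip K t v).2 ⊆ (N.gossip K t v).1 := by
  induction t with
  | zero => exact Set.empty_subset _
  | succ t ih =>
    intro x hx
    rw [mem_sent_succ] at hx
    rw [mem_gossip_succ]
    rcases hx with hx | hx
    · exact Or.inl (ih hx)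
    · left
      rcases nextItem_cases ih with ⟨h, -⟩ | ⟨y, h, hy, -⟩
      · rw [h] at hx; cases hx
      · rw [h] at hx; rwa [← Option.some.inj hx]

theorem sent_subset_gossip_of_adj (t : ℕ) {v u : Fin n} (h : N.graph.Adj v u) :
    (N.gossip K t u).2 ⊆ (N.gossip K t v).1 := by
  induction t with
  | zero => exact Set.empty_subset _
  | succ t ih =>
    intro x hx
    rw [mem_sent_succ] at hx
    rw [mem_gossip_succ]
    exact hx.imp (fun hx => ih hx) fun hx => ⟨u, h, hx⟩

theorem initial_subset_gossip (t : ℕ) (v : Fin n) : K v ⊆ (N.gossip K t v).1 := by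
  induction t with
  | zero => exact subset_rfl
  | succ t ih => exact fun x hx => N.mem_gossip_succ.2 (Or.inl (ih hx))

theorem gossip_subset (t : ℕ) (v : Fin n) : (N.gossip K t v).1 ⊆ ⋃ u, K u := by
  induction t generalizing v with
  | zero => exact Set.subset_iUnion K v
  | succ t ih =>
    intro x hx
    rcases N.mem_gossip_succ.1 hx with hx | ⟨u, -, hx⟩
    · exact ih v hx
    · rcases nextItem_cases (N.sent_subset_gossip t u) with ⟨h, -⟩ | ⟨y, h, hy, -⟩
      · rw [h] at hx; cases hx
      · rw [h] at hx
        rw [← Option.some.inj hx]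
        exact ih u hy

variable (K) in
/-- The items that start within distance `d` of `v`. -/
def itemsWithin (d : ℕ) (v : Fin n) : Set I := {x | ∃ u, N.graph.dist v u ≤ d ∧ x ∈ K u}

theorem itemsWithin_zero (v : Fin n) : N.itemsWithin K 0 v = K v := by
  ext x
  constructor
  · rintro ⟨u, hu, hx⟩
    rwa [N.connected.dist_eq_zero_iff.1 (Nat.le_zero.1 hu)]
  · exact fun hx => ⟨v, by simp, hx⟩

theorem itemsWithin_succ {d : ℕ} {v : Fin n} {x : I} (h : x ∈ N.itemsWithin K (d + 1) v) :
    x ∈ K v ∨ ∃ u, N.graph.Adj v u ∧ x ∈ N.itemsWithin K d u := by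
  obtain ⟨u, hu, hx⟩ := h
  rcases hd : N.graph.dist v u with _ | e
  · rw [N.connected.dist_eq_zero_iff.1 hd]
    exact Or.inl hx
  · obtain ⟨w, hw, hwd⟩ := N.connected.exists_adj_dist hd
    exact Or.inr ⟨w, hw, u, by omega, hx⟩

variable [Finite I]

/-- Either the count keeps pace with the rounds up to a delay given by `d`, or everything within
distance `d` has arrived. A node sends a new item or has already sent all it knows, so the bound
passes from known to sent items in one round. What a node sends its neighbours know, which takes the
bound from `d` to `d + 1`. -/
theorem gossip_progress (t : ℕ) : ∀ (d : ℕ) (v : Fin n),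
    (t ≤ (N.gossip K t v).1.ncard + d ∨ N.itemsWithin K d v ⊆ (N.gossip K t v).1) ∧
    (t ≤ (N.gossip K t v).2.ncard + d + 1 ∨ N.itemsWithin K d v ⊆ (N.gossip K t v).2) := by
  induction t with
  | zero => intro d v; exact ⟨Or.inl (Nat.zero_le _), Or.inl (Nat.zero_le _)⟩
  | succ t ih =>
    have sent : ∀ (d : ℕ) (v : Fin n), t + 1 ≤ (N.gossip K (t + 1) v).2.ncard + d + 1 ∨
        N.itemsWithin K d v ⊆ (N.gossip K (t + 1) v).2 := by
      intro d v
      have hsub : (N.gossip K t v).2 ⊆ (N.gossip K (t + 1) v).2 :=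
        fun x hx => N.mem_sent_succ.2 (Or.inl hx)
      rcases nextItem_cases (N.sent_subset_gossip (K := K) t v) with ⟨h, he⟩ | ⟨x, h, -, hx⟩
      · rcases (ih d v).1 with h1 | h1
        · left
          rw [← he] at h1
          have := Set.ncard_le_ncard hsub
          omega
        · right
          rw [← he] at h1
          exact h1.trans hsub
      · rcases (ih d v).2 with h1 | h1
        · left
          have hins : insert x (N.gossip K t v).2 ⊆ (N.gossip K (t + 1) v).2 :=
            Set.insert_subset (N.mem_sent_succ.2 (Or.inr h)) hsub
          have := Set.ncard_le_ncard hins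
          rw [Set.ncard_insert_of_notMem hx] at this
          omega
        · exact Or.inr (h1.trans hsub)
    intro d v
    refine ⟨?_, sent d v⟩
    rcases d with _ | d
    · right
      rw [itemsWithin_zero]
      exact N.initial_subset_gossip _ _
    -- One neighbour that has sent many items suffices; otherwise each neighbour has sent all that
    -- starts within `d` of it.
    · by_cases h : ∃ u, N.graph.Adj v u ∧ t + 1 ≤ (N.gossip K (t + 1) u).2.ncard + d + 1
      · obtain ⟨u, hu, hc⟩ := h
        left
        have := Set.ncard_le_ncard (N.sent_subset_gossip_of_adj (K := K) (t + 1) hu)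
        omega
      · right
        intro x hx
        rcases N.itemsWithin_succ hx with hx | ⟨u, hu, hx⟩
        · exact N.initial_subset_gossip _ _ hx
        · refine N.sent_subset_gossip_of_adj (t + 1) hu ?_
          exact (sent d u).resolve_left (fun hc => h ⟨u, hu, hc⟩) hx

/-- If the nodes with an item form a vertex cover, then after `3 r` rounds of gossip every node
knows either at least `r` items or all items. -/
theorem gossip_complete {Z : Set (Fin n)} {item : Fin n → I} (hitem : Function.Injective item)
    (hK : ∀ v, K v = {x | v ∈ Z ∧ x = item v})
    (hZ : ∀ x y, N.graph.Adj x y → x ∈ Z ∨ y ∈ Z) (r : ℕ) (v : Fin n) :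
    r ≤ (N.gossip K (3 * r) v).1.ncard ∨ (N.gossip K (3 * r) v).1 = item '' Z := by
  -- Radius `2 * r` leaves `r` of the `3 * r` rounds for items, and a ball of this radius has `r`
  -- cover vertices unless it is the whole graph.
  rcases (N.gossip_progress (K := K) (3 * r) (2 * r) v).1 with h | h
  · left; omega
  by_cases hw : ∃ w, 2 * r ≤ N.graph.dist w v
  · obtain ⟨w, hw⟩ := hw
    left
    have h1 := N.connected.le_ncard_cover_dist_lt hZ hw
    rw [← Set.ncard_image_of_injective _ hitem] at h1
    refine h1.trans (Set.ncard_le_ncard (Set.Subset.trans ?_ h))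
    rintro _ ⟨z, ⟨hz, hd⟩, rfl⟩
    exact ⟨z, by rwa [SimpleGraph.dist_comm], by rw [hK]; exact ⟨hz, rfl⟩⟩
  · right
    push Not at hw
    apply Set.Subset.antisymm
    · refine (N.gossip_subset _ v).trans ?_
      intro x hx
      obtain ⟨u, hu⟩ := Set.mem_iUnion.1 hx
      rw [hK] at hu
      exact ⟨u, hu.1, hu.2.symm⟩
    · rintro _ ⟨z, hz, rfl⟩
      exact h ⟨z, by rw [SimpleGraph.dist_comm]; exact (hw z).le, by rw [hK]; exact ⟨hz, rfl⟩⟩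

end Network

/-! ### Matchings, listings and exchange -/

/-- A symmetric relation with unique partners is a matching. -/
theorem exists_matching_of_rel {V : Type} [Finite V] {G : SimpleGraph V} {r : V → V → Prop}
    (hs : ∀ u v, r u v → r v u) (hadj : ∀ u v, r u v → G.Adj u v)
    (huniq : ∀ v u w, r v u → r v w → u = w) {k : ℕ} (hk : 2 * k ≤ {v | ∃ u, r v u}.ncard) :
    ∃ M : G.Subgraph, IsMatchingOfSize k M ∧ ∀ v, M.neighborSet v = {u | r v u} := by
  classical
  have := Fintype.ofFinite V
  let M : G.Subgraph :=
    { verts := {v | ∃ u, r v u}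
      Adj := r
      adj_sub := fun h => hadj _ _ h
      edge_vert := fun h => ⟨_, h⟩
      symm := ⟨hs⟩ }
  refine ⟨M, ⟨fun v hv => ?_, ?_⟩, fun v => rfl⟩
  · obtain ⟨u, hu⟩ := hv
    exact ⟨u, hu, fun w hw => huniq v w u hw hu⟩
  -- Each covered vertex is sent to its matching edge. Fibres have at most two elements, so there
  -- are at least half as many edges as covered vertices.
  · have hp : ∀ v : V, ∃ e : Sym2 V, (∃ u, r v u) → v ∈ e ∧ e ∈ M.edgeSet := by
      intro v
      by_cases h : ∃ u, r v u
      · obtain ⟨u, hu⟩ := h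
        exact ⟨s(v, u), fun _ => ⟨Sym2.mem_mk_left v u, hu⟩⟩
      · exact ⟨s(v, v), fun h' => (h h').elim⟩
    choose e he using hp
    have hle := Finset.card_le_mul_card_image_of_maps_to
      (s := {v | ∃ u, r v u}.toFinset) (t := M.edgeSet.toFinset) (f := e)
      (fun v hv => by
        rw [Set.mem_toFinset] at *
        exact (he v hv).2) 2 (by
      intro b _
      induction b using Sym2.ind with
      | _ x y =>
        refine (Finset.card_le_card (t := {x, y}) ?_).trans Finset.card_le_two
        intro v hv
        rw [Finset.mem_filter, Set.mem_toFinset] at hv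
        have := (he v hv.1).1
        rw [hv.2, Sym2.mem_iff] at this
        simpa using this)
    rw [← Set.ncard_eq_toFinset_card', ← Set.ncard_eq_toFinset_card'] at hle
    omega

/-- The edges of a matching of size `k`, as two lists of endpoints. -/
theorem IsMatchingOfSize.exists_endpoints {V : Type} [Finite V] {G : SimpleGraph V} {k : ℕ}
    {M : G.Subgraph} (hM : IsMatchingOfSize k M) :
    ∃ f g : Fin k → V, (∀ i, G.Adj (f i) (g i)) ∧ Function.Injective (Sum.elim f g) := by
  classical
  have := Fintype.ofFinite V
  have hc : Fintype.card (Fin k) ≤ Fintype.card M.edgeSet := by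
    rw [Fintype.card_fin, ← Set.toFinset_card, ← Set.ncard_eq_toFinset_card']
    exact hM.2
  obtain ⟨e⟩ := Function.Embedding.nonempty_of_card_le hc
  have hp : ∀ i, ∃ x y, M.Adj x y ∧ (e i : Sym2 V) = s(x, y) := by
    intro i
    obtain ⟨b, hb⟩ := e i
    induction b using Sym2.ind with
    | _ x y => exact ⟨x, y, hb, rfl⟩
  choose f g hadj he using hp
  have hu : ∀ x y z, M.Adj x y → M.Adj x z → y = z := fun x y z hy hz =>
    (hM.1 (M.edge_vert hy)).unique hy hz
  have inj : ∀ i j, s(f i, g i) = s(f j, g j) → i = j := by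
    intro i j h
    rw [← he, ← he] at h
    exact e.injective (Subtype.ext h)
  refine ⟨f, g, fun i => (hadj i).adj_sub, Function.Injective.sumElim ?_ ?_ ?_⟩
  · intro i j h
    have hj := hadj j
    rw [← h] at hj
    exact inj i j (by rw [← h, hu _ _ _ (hadj i) hj])
  · intro i j h
    have hj := (hadj j).symm
    rw [← h] at hj
    exact inj i j (by rw [← h, hu _ _ _ (hadj i).symm hj])
  · intro i j h
    have hj := (hadj j).symm
    rw [← h] at hj
    have hij := inj i j (by rw [← h, hu _ _ _ (hadj i) hj]; exact Sym2.eq_swap)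
    rw [hij] at h
    exact (hadj j).ne h

theorem exists_listing {γ : Type} [Finite γ] (m : ℕ) (C : Set γ) :
    ∃ f : Fin m → Option γ, (∀ j c, f j = some c → c ∈ C) ∧
      ((∀ c ∈ C, ∃ j, f j = some c) ∨ m ≤ {c | ∃ j, f j = some c}.ncard) := by
  classical
  have := Fintype.ofFinite γ
  rcases le_total m (Fintype.card C) with h | h
  · obtain ⟨e⟩ := Function.Embedding.nonempty_of_card_le (α := Fin m) (β := C) (by simpa using h)
    refine ⟨fun j => some (e j), ?_, Or.inr ?_⟩
    · intro j c hc
      rw [← Option.some.inj hc]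
      exact (e j).2
    · have : {c | ∃ j, some (e j : γ) = some c} = Set.range fun j => (e j : γ) := by
        ext c; simp
      rw [this, ← Set.image_univ, Set.ncard_image_of_injective
        (f := fun j => (e j : γ)) _ (Subtype.val_injective.comp e.injective), Set.ncard_univ, Nat.card_fin]
  · obtain ⟨e⟩ := Function.Embedding.nonempty_of_card_le (α := C) (β := Fin m) (by simpa using h)
    refine ⟨fun j => if h : ∃ c, e c = j then some h.choose else none, ?_, Or.inl ?_⟩
    · intro j c hc
      dsimp only at hc
      split_ifs at hc with h
      rw [← Option.some.inj hc]
      exact h.choose.2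
    · intro c hc
      have h : ∃ d, e d = e ⟨c, hc⟩ := ⟨_, rfl⟩
      refine ⟨e ⟨c, hc⟩, ?_⟩
      dsimp only
      rw [dif_pos h, e.injective h.choose_spec]

/-- A list of `m` entries that names all elements of `C`, or at least `m` of them. -/
noncomputable def listing {γ : Type} [Finite γ] (m : ℕ) (C : Set γ) : Fin m → Option γ :=
  (exists_listing m C).choose

theorem mem_of_listing {γ : Type} [Finite γ] {m : ℕ} {C : Set γ} {j : Fin m} {c : γ}
    (h : listing m C j = some c) : c ∈ C :=
  (exists_listing m C).choose_spec.1 j c h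

theorem listing_complete {γ : Type} [Finite γ] (m : ℕ) (C : Set γ) :
    (∀ c ∈ C, ∃ j, listing m C j = some c) ∨ m ≤ {c | ∃ j, listing m C j = some c}.ncard :=
  (exists_listing m C).choose_spec.2

/-- In a system of pairs `(p i, g i)` of distinct codes, every `g i` can be exchanged for an
element of `D i`, if it is not one already and `D i` is large. -/
theorem exists_injective_exchange {γ : Type} [Finite γ] {k : ℕ} {p g : Fin k → γ}
    {D : Fin k → Set γ} (hinj : Function.Injective (Sum.elim p g))
    (hD : ∀ i, g i ∈ D i ∨ 2 * k ≤ (D i).ncard) :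
    ∃ g' : Fin k → γ, Function.Injective (Sum.elim p g') ∧ ∀ i, g' i ∈ D i := by
  classical
  -- Indices are treated one at a time. The untreated ones keep their value under `g`, so `hD` still
  -- applies to them.
  suffices H : ∀ s : Finset (Fin k), ∃ g' : Fin k → γ, Function.Injective (Sum.elim p g') ∧
      (∀ i ∈ s, g' i ∈ D i) ∧ ∀ i ∉ s, g' i = g i by
    obtain ⟨g', h1, h2, -⟩ := H Finset.univ
    exact ⟨g', h1, fun i => h2 i (Finset.mem_univ i)⟩
  intro s
  induction s using Finset.induction_on with
  | empty => exact ⟨g, hinj, by simp, by simp⟩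
  | insert b s hb ih =>
    obtain ⟨g', h1, h2, h3⟩ := ih
    by_cases hmem : g' b ∈ D b
    · refine ⟨g', h1, fun i hi => ?_, fun i hi => h3 i fun h => hi (Finset.mem_insert_of_mem h)⟩
      rcases Finset.mem_insert.1 hi with rfl | hi
      · exact hmem
      · exact h2 i hi
    · have hlarge := (hD b).resolve_left (by rwa [← h3 b hb])
      -- The codes in use elsewhere number at most `k + (k - 1)`, so a set `D b` with `2 * k`
      -- elements has an unused one.
      let U : Finset γ := Finset.univ.image p ∪ (Finset.univ.erase b).image g'
      have hU : U.card < 2 * k := by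
        have c1 : (Finset.univ.image p).card ≤ k := Finset.card_image_le.trans (by simp)
        have c2 : ((Finset.univ.erase b).image g').card ≤ k - 1 :=
          Finset.card_image_le.trans (by simp)
        have := Finset.card_union_le (Finset.univ.image p) ((Finset.univ.erase b).image g')
        have := b.pos
        simp only [U]
        omega
      obtain ⟨c, hc, hcU⟩ : ∃ c ∈ D b, c ∉ (U : Set γ) := by
        by_contra! hcon
        have := Set.ncard_le_ncard (s := D b) (t := U) hcon
        rw [Set.ncard_coe_finset] at this
        omega
      have hp : ∀ i, p i ≠ c := fun i h => hcU (by simp [U, ← h])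
      have hg : ∀ i, i ≠ b → g' i ≠ c := fun i hi h =>
        hcU (by
          simp only [U, Finset.coe_union, Set.mem_union, Finset.mem_coe, Finset.mem_image]
          exact Or.inr ⟨i, by simp [hi], h⟩)
      refine ⟨Function.update g' b c, Function.Injective.sumElim (fun i j h => ?_)
        (fun i j h => ?_) (fun i j => ?_), fun i hi => ?_, fun i hi => ?_⟩
      · exact Sum.inl.inj (h1 (a₁ := Sum.inl i) (a₂ := Sum.inl j) h)
      · by_cases hi : i = b <;> by_cases hj : j = b
        · rw [hi, hj]
        · subst hi
          rw [Function.update_self, Function.update_of_ne hj] at h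
          exact (hg j hj h.symm).elim
        · subst hj
          rw [Function.update_self, Function.update_of_ne hi] at h
          exact (hg i hi h).elim
        · rw [Function.update_of_ne hi, Function.update_of_ne hj] at h
          exact Sum.inr.inj (h1 (a₁ := Sum.inr i) (a₂ := Sum.inr j) h)
      · by_cases hj : j = b
        · subst hj
          rw [Function.update_self]
          exact hp i
        · rw [Function.update_of_ne hj]
          intro h
          have := h1 (a₁ := Sum.inl i) (a₂ := Sum.inr j) h
          cases this
      · by_cases hib : i = b
        · subst hib
          rwa [Function.update_self]
        · rw [Function.update_of_ne hib]
          exact h2 i ((Finset.mem_insert.1 hi).resolve_left hib)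
      · rw [Finset.mem_insert, not_or] at hi
        rw [Function.update_of_ne hi.1]
        exact h3 i hi.2

/-! ### The algorithm for maximum matching -/

/-- What a node announces about itself: an identifier, a label, and a list of codes of
neighbours. A code consists of the information whether the node is matched, and its label. -/
abbrev Item (ι Λ : Type) (k : ℕ) : Type := ι × Λ × (Fin (2 * k) → Option (Bool × Λ))

section Local

variable {ι Λ : Type}

/-- The item of a node that has heard the codes `S`. -/
noncomputable def localItem [Finite Λ] (k : ℕ) (i : ι) (l : Λ) (S : Set (ι × Bool × Λ)) :
    Item ι Λ k :=
  (i, l, listing (2 * k) {c | ∃ j, (j, c) ∈ S})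

/-- The initial items of a node: matched nodes and nodes with a free neighbour have one. -/
def localItems [Finite Λ] (k : ℕ) (i : ι) (l : Λ) (m : Option ι) (S : Set (ι × Bool × Λ)) :
    Set (Item ι Λ k) :=
  {x | (m.isSome ∨ ∃ j l', (j, false, l') ∈ S) ∧ x = localItem k i l S}

/-- A matching with `k` edges between codes: the `i`-th edge joins the code of a matched node with
label `s.1 i`, whose item is in `K`, to a code `s.2 i` that is listed by this item. -/
def IsCodeMatching {k : ℕ} (K : Set (Item ι Λ k)) (s : (Fin k → Λ) × (Fin k → Bool × Λ)) : Prop :=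
  Function.Injective (Sum.elim (fun i => (true, s.1 i)) s.2) ∧
    ∀ i, ∃ x ∈ K, x.2.1 = s.1 i ∧ ∃ j, x.2.2 j = some (s.2 i)

/-- Some matching with `k` edges between codes, if there is one. -/
noncomputable def codeMatching {k : ℕ} (K : Set (Item ι Λ k)) :
    Option ((Fin k → Λ) × (Fin k → Bool × Λ)) :=
  open Classical in if h : ∃ s, IsCodeMatching K s then some h.choose else none

theorem codeMatching_eq_some {k : ℕ} {K : Set (Item ι Λ k)}
    {s : (Fin k → Λ) × (Fin k → Bool × Λ)} (h : codeMatching K = some s) : IsCodeMatching K s := by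
  unfold codeMatching at h
  split_ifs at h with h'
  rw [← Option.some.inj h]
  exact h'.choose_spec

theorem codeMatching_eq_none {k : ℕ} {K : Set (Item ι Λ k)} (h : codeMatching K = none) :
    ¬ ∃ s, IsCodeMatching K s := by
  unfold codeMatching at h
  split_ifs at h with h'
  exact h'

/-- A matched node picks a neighbour with the code to which its own code is matched. -/
noncomputable def localPick {k : ℕ} (m : Option ι) (l : Λ) (S : Set (ι × Bool × Λ))
    (K : Set (Item ι Λ k)) : Option ι :=
  open Classical in
  if h : ∃ p s i, codeMatching K = some s ∧ m.isSome ∧ s.1 i = l ∧ (p, s.2 i) ∈ S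
  then some h.choose else none

/-- The identifiers of the partners of a node in the output, for the greedy partner `m`, the
known items `K`, the own pick `pick` and the received picks `M`. -/
noncomputable def localOutput {k : ℕ} (i : ι) (m : Option ι) (K : Set (Item ι Λ k))
    (pick : Option ι) (M : Set (ι × Option ι)) : Option (Set ι) :=
  open Classical in
  if 2 * k ≤ K.ncard then some {p | m = some p}
  else if codeMatching K = none then none
  else some {p | pick = some p ∨ (p, some i) ∈ M}

end Local

namespace Network

variable {a n : ℕ} (N : Network a n) {Λ : Type} (k : ℕ) (h : Fin n → Λ)

/-- The code of a node: whether it is matched greedily, and its label. -/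
noncomputable def code (v : Fin n) : Bool × Λ := ((N.greedy k v).isSome, h v)

theorem code_injOn {N : Network a n} {k : ℕ} {h : Fin n → Λ}
    (hinj : Set.InjOn h (matched (N.greedy k))) {u v : Fin n} {l : Λ}
    (hu : N.code k h u = (true, l)) (hv : N.code k h v = (true, l)) : u = v := by
  have hu' := Prod.ext_iff.1 hu
  have hv' := Prod.ext_iff.1 hv
  exact hinj (mem_matched.2 hu'.1) (mem_matched.2 hv'.1) (hu'.2.trans hv'.2.symm)

variable [Finite Λ]

/-- The item of a node. -/
noncomputable def item (v : Fin n) : Item (Fin (n ^ a)) Λ k :=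
  localItem k (N.vid v) (h v) (N.heard (N.code k h) v)

/-- The initial items of a node. -/
noncomputable def items (v : Fin n) : Set (Item (Fin (n ^ a)) Λ k) :=
  localItems k (N.vid v) (h v) (N.greedy k v) (N.heard (N.code k h) v)

/-- The items that a node knows after the gossip. -/
noncomputable def knownItems (v : Fin n) : Set (Item (Fin (n ^ a)) Λ k) :=
  (N.gossip (N.items k h) (3 * (2 * k)) v).1

/-- The neighbour that a node picks. -/
noncomputable def pick (v : Fin n) : Option (Fin (n ^ a)) :=
  localPick (N.greedy k v) (h v) (N.heard (N.code k h) v) (N.knownItems k h v)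

/-- The output of the matching algorithm, if the nodes have labels `h`. -/
noncomputable def matchingOutput (v : Fin n) : Option (Set ℕ) :=
  (localOutput (N.vid v) (N.greedy k v) (N.knownItems k h v) (N.pick k h v)
    (N.heard (N.pick k h) v)).map fun S => Fin.val '' S

/-! ### Correctness of the matching algorithm -/

variable {N k h}

theorem item_injective : Function.Injective (N.item k h) := fun _ _ e =>
  N.vid_injective (congrArg Prod.fst e)

theorem image_partners {s : Option (Fin (n ^ a))} {r : Fin n → Prop}
    (hs : ∀ p, s = some p ↔ ∃ u, N.vid u = p ∧ r u) :
    Fin.val '' {p | s = some p} = N.ident '' {u | r u} := by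
  ext j
  constructor
  · rintro ⟨p, hp, rfl⟩
    obtain ⟨u, rfl, hu⟩ := (hs p).1 hp
    exact ⟨u, hu, rfl⟩
  · rintro ⟨u, hu, rfl⟩
    exact ⟨N.vid u, (hs _).2 ⟨u, rfl, hu⟩, rfl⟩

/-- The nodes that start the gossip with an item. -/
def carriers (m : Fin n → Option (Fin (n ^ a))) (N : Network a n) : Set (Fin n) :=
  {v | v ∈ matched m ∨ ∃ u, N.graph.Adj v u ∧ u ∉ matched m}

theorem mem_items {v : Fin n} {x : Item (Fin (n ^ a)) Λ k} :
    x ∈ N.items k h v ↔ v ∈ carriers (N.greedy k) N ∧ x = N.item k h v := by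
  refine and_congr_left fun _ => or_congr mem_matched.symm ⟨?_, ?_⟩
  · rintro ⟨_, l, u, hu, he⟩
    refine ⟨u, hu, ?_⟩
    have := congrArg (fun p => p.2.1) he
    rw [mem_matched]
    simpa [code] using this.symm
  · rintro ⟨u, hu, hm⟩
    rw [mem_matched] at hm
    exact ⟨N.vid u, h u, u, hu, by simp [code, hm]⟩

theorem matched_subset_carriers : (matched (N.greedy k) : Set (Fin n)) ⊆ carriers (N.greedy k) N :=
  fun _ hv => Or.inl hv

/-- The carriers cover all edges even if the greedy matching is not maximal: an edge with a free end
has a carrier at its other end. This is why nodes with a free neighbour also start with an item. -/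
theorem knownItems_cases (v : Fin n) : 2 * k ≤ (N.knownItems k h v).ncard ∨
    N.knownItems k h v = N.item k h '' carriers (N.greedy k) N := by
  refine N.gossip_complete item_injective (fun v => Set.ext fun x => mem_items) ?_ (2 * k) v
  intro x y hxy
  by_cases hy : y ∈ matched (N.greedy k)
  · exact Or.inr (Or.inl hy)
  · exact Or.inl (Or.inr ⟨y, hxy, hy⟩)

/-- Matched nodes are carriers, so both outcomes of the gossip give every node `2 * k` items, and
all nodes choose the greedy branch. -/
theorem exists_matching_of_large_greedy (hl : 2 * k ≤ (matched (N.greedy k)).card) :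
    ∃ M : N.graph.Subgraph, IsMatchingOfSize k M ∧
      ∀ v, N.matchingOutput k h v = some (N.ident '' M.neighborSet v) := by
  have hm := N.isMating_greedy k
  have huniq : ∀ v u w, N.greedy k v = some (N.vid u) → N.greedy k v = some (N.vid w) → u = w :=
    fun v u w hu hw => N.vid_injective (Option.some.inj (hu.symm.trans hw))
  have hsymm : ∀ u v, N.greedy k u = some (N.vid v) →
      N.graph.Adj u v ∧ N.greedy k v = some (N.vid u) := by
    intro u v huv
    obtain ⟨w, hw, hadj, hwu⟩ := hm u _ huv
    obtain rfl := N.vid_injective hw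
    exact ⟨hadj, hwu⟩
  obtain ⟨M, hM, hMv⟩ := exists_matching_of_rel (G := N.graph)
    (r := fun v u => N.greedy k v = some (N.vid u)) (fun u v e => (hsymm u v e).2)
    (fun u v e => (hsymm u v e).1) huniq (k := k) (by
      refine hl.trans ?_
      rw [← Set.ncard_coe_finset]
      refine Set.ncard_le_ncard fun v hv => ?_
      obtain ⟨p, hp⟩ := Option.isSome_iff_exists.1 (mem_matched.1 hv)
      obtain ⟨u, rfl, -⟩ := hm v p hp
      exact ⟨u, hp⟩)
  refine ⟨M, hM, fun v => ?_⟩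
  have hK : 2 * k ≤ (N.knownItems k h v).ncard := by
    rcases knownItems_cases (N := N) (k := k) (h := h) v with hK | hK
    · exact hK
    · rw [hK, Set.ncard_image_of_injective _ item_injective]
      refine hl.trans ?_
      rw [← Set.ncard_coe_finset]
      exact Set.ncard_le_ncard matched_subset_carriers
  unfold matchingOutput localOutput
  rw [if_pos hK, hMv, Option.map_some]
  congr 1
  refine image_partners fun p => ⟨fun hp => ?_, ?_⟩
  · obtain ⟨u, rfl, -⟩ := hm v p hp
    exact ⟨u, rfl, hp⟩
  · rintro ⟨u, rfl, hu⟩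
    exact hu

theorem maximal_of_small (hl : (matched (N.greedy k)).card < 2 * k) {v u : Fin n}
    (huv : N.graph.Adj v u) : v ∈ matched (N.greedy k) ∨ u ∈ matched (N.greedy k) :=
  (N.greedy_large_or_maximal k).resolve_left hl.not_ge v u huv

/-- By maximality only matched nodes are carriers, so there are too few items for the first outcome
of the gossip. Hence all nodes evaluate `codeMatching` on the same set. -/
theorem knownItems_of_small (hl : (matched (N.greedy k)).card < 2 * k) (v : Fin n) :
    N.knownItems k h v = N.item k h '' matched (N.greedy k) := by
  have hc : carriers (N.greedy k) N = matched (N.greedy k) := by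
    refine Set.Subset.antisymm ?_ matched_subset_carriers
    rintro v (hv | ⟨u, hu, hm⟩)
    · exact hv
    · exact (maximal_of_small hl hu).resolve_right hm
  rw [← hc]
  refine knownItems_cases v |>.resolve_left fun hK => ?_
  have := Set.ncard_le_ncard (N.gossip_subset (K := N.items k h) (3 * (2 * k)) v)
  have he : ⋃ u, N.items k h u = N.item k h '' matched (N.greedy k) := by
    ext x
    simp only [Set.mem_iUnion, mem_items, hc]
    exact ⟨fun ⟨u, hu, e⟩ => ⟨u, hu, e.symm⟩, fun ⟨u, hu, e⟩ => ⟨u, hu, e.symm⟩⟩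
  rw [he, Set.ncard_image_of_injective _ item_injective, Set.ncard_coe_finset] at this
  change (N.knownItems k h v).ncard ≤ _ at this
  omega

theorem ncard_knownItems_of_small (hl : (matched (N.greedy k)).card < 2 * k) (v : Fin n) :
    ¬ 2 * k ≤ (N.knownItems k h v).ncard := by
  rw [knownItems_of_small hl, Set.ncard_image_of_injective _ item_injective,
    Set.ncard_coe_finset]
  omega

section Decode

variable {s : (Fin k → Λ) × (Fin k → Bool × Λ)}

theorem pick_spec (hl : (matched (N.greedy k)).card < 2 * k)
    (hs : codeMatching (N.item k h '' matched (N.greedy k)) = some s) {v : Fin n}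
    {p : Fin (n ^ a)} (hp : N.pick k h v = some p) :
    ∃ u i, N.vid u = p ∧ N.graph.Adj v u ∧ N.code k h v = (true, s.1 i) ∧
      N.code k h u = s.2 i := by
  unfold pick localPick at hp
  split_ifs at hp with hex
  obtain ⟨s', i, hs', hv, hi, u, hu, he⟩ := hex.choose_spec
  rw [knownItems_of_small hl, hs, Option.some.injEq] at hs'
  subst hs'
  rw [Prod.mk.injEq] at he
  refine ⟨u, i, ?_, hu, by simp [code, hv, hi], he.2.symm⟩
  rw [← Option.some.inj hp, he.1]

theorem exists_pick (hl : (matched (N.greedy k)).card < 2 * k)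
    (hs : codeMatching (N.item k h '' matched (N.greedy k)) = some s) (i : Fin k) :
    ∃ v p, N.code k h v = (true, s.1 i) ∧ N.pick k h v = some p := by
  obtain ⟨_, ⟨v, hv, rfl⟩, hi, j, hj⟩ := (codeMatching_eq_some hs).2 i
  have hm : (N.greedy k v).isSome := mem_matched.1 hv
  obtain ⟨q, hq⟩ := mem_of_listing hj
  have hex : ∃ p s i, codeMatching (N.knownItems k h v) = some s ∧ (N.greedy k v).isSome ∧
      s.1 i = h v ∧ (p, s.2 i) ∈ N.heard (N.code k h) v :=
    ⟨q, s, i, by rw [knownItems_of_small hl, hs], hm, hi.symm, hq⟩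
  refine ⟨v, hex.choose, ?_, ?_⟩
  · rw [← hi]
    exact Prod.ext hm rfl
  · unfold pick localPick
    rw [dif_pos hex]

/-- Distinct labels on the matched nodes give each left code a single owner, which picks one
neighbour with the right code. Free nodes may share a code harmlessly: each right code belongs to
one pair and thus is picked by one owner. -/
theorem exists_matching_of_codeMatching (hl : (matched (N.greedy k)).card < 2 * k)
    (hinj : Set.InjOn h (matched (N.greedy k)))
    (hs : codeMatching (N.item k h '' matched (N.greedy k)) = some s) :
    ∃ M : N.graph.Subgraph, IsMatchingOfSize k M ∧
      ∀ v, N.matchingOutput k h v = some (N.ident '' M.neighborSet v) := by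
  have hsinj := (codeMatching_eq_some hs).1
  have spec : ∀ {v u : Fin n}, N.pick k h v = some (N.vid u) →
      ∃ i, N.graph.Adj v u ∧ N.code k h v = (true, s.1 i) ∧ N.code k h u = s.2 i := by
    intro v u hp
    obtain ⟨w, i, hw, h1, h2, h3⟩ := pick_spec hl hs hp
    obtain rfl := N.vid_injective hw
    exact ⟨i, h1, h2, h3⟩
  have ne : ∀ {v i j}, N.code k h v = (true, s.1 i) → N.code k h v ≠ s.2 j := by
    intro v i j h1 h2
    cases hsinj (a₁ := Sum.inl i) (a₂ := Sum.inr j) (h1.symm.trans h2)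
  let r : Fin n → Fin n → Prop := fun v u =>
    N.pick k h v = some (N.vid u) ∨ N.pick k h u = some (N.vid v)
  obtain ⟨M, hM, hMv⟩ := exists_matching_of_rel (G := N.graph) (r := r) (k := k)
    (fun u v e => e.symm)
    (fun u v e => e.elim (fun e => (spec e).choose_spec.1) fun e => (spec e).choose_spec.1.symm)
    (by
      -- In the mixed cases the code of `v` would be both a left and a right code. If `u` and `w`
      -- both pick `v`, they own the left code of the same pair.
      rintro v u w (hu | hu) (hw | hw)
      · exact N.vid_injective (Option.some.inj (hu.symm.trans hw))
      · obtain ⟨i, -, hi, -⟩ := spec hu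
        obtain ⟨j, -, -, hj⟩ := spec hw
        exact (ne hi hj).elim
      · obtain ⟨i, -, -, hi⟩ := spec hu
        obtain ⟨j, -, hj, -⟩ := spec hw
        exact (ne hj hi).elim
      · obtain ⟨i, -, hi, hi'⟩ := spec hu
        obtain ⟨j, -, hj, hj'⟩ := spec hw
        have hij := hsinj (a₁ := Sum.inr i) (a₂ := Sum.inr j) (hi'.symm.trans hj')
        rw [← Sum.inr.inj hij] at hj
        exact code_injOn hinj hi hj)
    (by
      -- All `2 * k` distinct codes occur at covered nodes, so at least `2 * k` nodes are covered.
      have hsub : Set.range (Sum.elim (fun i => (true, s.1 i)) s.2) ⊆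
          N.code k h '' {v | ∃ u, r v u} := by
        rintro _ ⟨i | i, rfl⟩ <;> obtain ⟨v, p, hv, hp⟩ := exists_pick hl hs i <;>
          obtain ⟨u, j, rfl, -, hj, hu⟩ := pick_spec hl hs hp
        · exact ⟨v, ⟨u, Or.inl hp⟩, hv⟩
        · have hij := hsinj (a₁ := Sum.inl i) (a₂ := Sum.inl j) (hv.symm.trans hj)
          rw [← Sum.inl.inj hij] at hu
          exact ⟨u, ⟨v, Or.inr hp⟩, hu⟩
      have h1 := Set.ncard_le_ncard hsub
      rw [← Set.image_univ, Set.ncard_image_of_injective _ hsinj, Set.ncard_univ,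
        Nat.card_sum, Nat.card_fin] at h1
      have h2 := Set.ncard_image_le (f := N.code k h) (s := {v | ∃ u, r v u})
      omega)
  refine ⟨M, hM, fun v => ?_⟩
  unfold matchingOutput localOutput
  rw [if_neg (ncard_knownItems_of_small hl v), if_neg (by rw [knownItems_of_small hl, hs]; simp),
    hMv, Option.map_some]
  congr 1
  ext j
  constructor
  · rintro ⟨p, hp | hp, rfl⟩
    · obtain ⟨u, -, rfl, -⟩ := pick_spec hl hs hp
      exact ⟨u, Or.inl hp, rfl⟩
    · obtain ⟨u, hu, he⟩ := hp
      rw [Prod.mk.injEq] at he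
      refine ⟨u, Or.inr he.2.symm, ?_⟩
      rw [he.1]; rfl
  · rintro ⟨u, hu | hu, rfl⟩
    · exact ⟨N.vid u, Or.inl hu, rfl⟩
    · exact ⟨N.vid u, Or.inr ((N.mem_heard _ _ _ _).2 ⟨(spec hu).choose_spec.1.symm, hu⟩), rfl⟩

end Decode

/-- Each edge can be oriented to start at a matched node, since these form a cover. Distinct labels
make the codes of all endpoints distinct. A list that misses the code of `g i` has `2 * k` distinct
entries, so the exchange lemma applies. -/
theorem exists_isCodeMatching (hl : (matched (N.greedy k)).card < 2 * k) {f g : Fin k → Fin n}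
    (hadj : ∀ i, N.graph.Adj (f i) (g i)) (hfg : Function.Injective (Sum.elim f g))
    (hinj : Set.InjOn h (Set.range (Sum.elim f g))) :
    ∃ s, IsCodeMatching (N.item k h '' matched (N.greedy k)) s := by
  wlog hf : ∀ i, f i ∈ matched (N.greedy k) generalizing f g
  · let P : Fin k → Prop := fun i => f i ∈ matched (N.greedy k)
    classical
    let σ : Fin k ⊕ Fin k → Fin k ⊕ Fin k :=
      Sum.elim (fun i => if P i then Sum.inl i else Sum.inr i)
        (fun i => if P i then Sum.inr i else Sum.inl i)
    have hσ : Function.Injective σ := by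
      rintro (i | i) (j | j) e <;> simp only [σ, Sum.elim_inl, Sum.elim_inr] at e <;>
        split_ifs at e <;> simp_all
    have he : Sum.elim (fun i => if P i then f i else g i) (fun i => if P i then g i else f i) =
        Sum.elim f g ∘ σ := by
      funext x
      rcases x with i | i <;> simp only [σ, Sum.elim_inl, Sum.elim_inr, Function.comp] <;>
        split_ifs <;> rfl
    refine this (f := fun i => if P i then f i else g i) (g := fun i => if P i then g i else f i)
      ?_ ?_ ?_ ?_
    · intro i
      split_ifs
      · exact hadj i
      · exact (hadj i).symm
    · rw [he]; exact hfg.comp hσ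
    · rw [he]; exact hinj.mono (Set.range_comp_subset_range _ _)
    · intro i
      split_ifs with hi
      · exact hi
      · exact (maximal_of_small hl (hadj i)).resolve_left hi
  have hcode : Function.Injective (Sum.elim (fun i => (true, h (f i))) fun i => N.code k h (g i)) := by
    have : Sum.elim (fun i => (true, h (f i))) (fun i => N.code k h (g i)) =
        N.code k h ∘ Sum.elim f g := by
      funext x
      rcases x with i | i
      · exact Prod.ext (mem_matched.1 (hf i)).symm rfl
      · rfl
    rw [this]
    intro x y e
    exact hfg (hinj ⟨x, rfl⟩ ⟨y, rfl⟩ (congrArg Prod.snd e))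
  obtain ⟨g', h1, h2⟩ := exists_injective_exchange
    (D := fun i => {c | ∃ j, (N.item k h (f i)).2.2 j = some c}) hcode (fun i => by
      refine (listing_complete (2 * k) _).imp_left fun hc => hc _ ?_
      exact ⟨N.vid (g i), (N.mem_heard _ _ _ _).2 ⟨hadj i, rfl⟩⟩)
  exact ⟨(fun i => h (f i), g'), h1, fun i => ⟨_, ⟨f i, hf i, rfl⟩, rfl, h2 i⟩⟩

variable (N k) in
/-- The algorithm is correct if the labels are distinct on a certain set of at most `4 k` nodes
that does not depend on the labels. -/
theorem isKMaxMOutput_matchingOutput : ∃ W : Finset (Fin n), W.card ≤ 4 * k ∧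
    ∀ (Λ : Type) [Finite Λ] (h : Fin n → Λ), Set.InjOn h W →
      N.IsKMaxMOutput k (N.matchingOutput k h) := by
  classical
  rcases le_or_gt (2 * k) (matched (N.greedy k)).card with hl | hl
  · refine ⟨∅, by simp, fun Λ _ h _ => ?_⟩
    have hM := exists_matching_of_large_greedy (h := h) hl
    exact ⟨fun _ => hM, fun hno => (hno (hM.imp fun _ hM => hM.1)).elim⟩
  have key : ∃ U : Finset (Fin n), U.card ≤ 2 * k ∧ ∀ (Λ : Type) [Finite Λ] (h : Fin n → Λ),
      Set.InjOn h U → (∃ M : N.graph.Subgraph, IsMatchingOfSize k M) →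
        ∃ s, IsCodeMatching (N.item k h '' matched (N.greedy k)) s := by
    by_cases hM : ∃ M : N.graph.Subgraph, IsMatchingOfSize k M
    · obtain ⟨M, hM⟩ := hM
      obtain ⟨f, g, hadj, hfg⟩ := hM.exists_endpoints
      -- The endpoints of one fixed matching, chosen before the labels are quantified; this
      -- independence is what the union bound uses.
      refine ⟨Finset.univ.image (Sum.elim f g), Finset.card_image_le.trans ?_, ?_⟩
      · simp [two_mul]
      · intro Λ _ h hinj _
        exact exists_isCodeMatching hl hadj hfg (by simpa using hinj)
    · exact ⟨∅, by simp, fun _ _ _ _ h => (hM h).elim⟩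
  obtain ⟨U, hU, hUW⟩ := key
  refine ⟨matched (N.greedy k) ∪ U, (Finset.card_union_le _ _).trans (by omega),
    fun Λ _ h hinj => ?_⟩
  rw [Finset.coe_union] at hinj
  have hex := hUW Λ h (hinj.mono Set.subset_union_right)
  rcases hs : codeMatching (N.item k h '' matched (N.greedy k)) with _ | s
  · refine ⟨fun hM => (codeMatching_eq_none hs (hex hM)).elim, fun _ v => ?_⟩
    unfold matchingOutput localOutput
    rw [if_neg (ncard_knownItems_of_small hl v), if_pos (by rw [knownItems_of_small hl, hs])]
    rfl
  · have hM := exists_matching_of_codeMatching hl (hinj.mono Set.subset_union_left) hs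
    exact ⟨fun _ => hM, fun hno => (hno (hM.imp fun _ hM => hM.1)).elim⟩

end Network

/-! ### Implementation in rounds -/

theorem Implements.exchange {a n κ b q : ℕ} {σ τ μ : Type} [Finite μ] (hq : 0 < q)
    (hμ : Nat.card μ ≤ 2 ^ (b * q)) (m : σ → μ) (f : σ → Set (Fin (n ^ a) × μ) → τ) :
    Implements (a := a) (n := n) κ b q fun N x v => f (x v) (N.heard (fun u => m (x u)) v) :=
  fun _ _ hy => hy.exchange hq hμ m f

namespace Network

variable {a n κ b q k : ℕ} {Λ : Type}

/-- One iteration of the greedy matching, for nodes that know their identifiers. -/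
noncomputable def greedyOp (N : Network a n) (x : Fin n → (Fin (n ^ a) × Λ) × Option (Fin (n ^ a)))
    (v : Fin n) : (Fin (n ^ a) × Λ) × Option (Fin (n ^ a)) :=
  let p := fun u => localPointer (x u).2 (N.heard (fun w => (x w).2.isNone) u)
  ((x v).1, localMatch (x v).1.1 (x v).2 (p v) (N.heard p v))

theorem implements_greedyOp (hq : 0 < q) (h1 : Nat.card Bool ≤ 2 ^ (b * q))
    (h2 : Nat.card (Option (Fin (n ^ a))) ≤ 2 ^ (b * q)) :
    Implements (a := a) (n := n) κ b (q + q) (greedyOp (Λ := Λ)) :=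
  (Implements.exchange hq h1 (fun x : (Fin (n ^ a) × Λ) × Option (Fin (n ^ a)) => x.2.isNone)
    (fun x S => (x, localPointer x.2 S))).comp
    (Implements.exchange hq h2 (fun z => z.2)
      (fun z S => (z.1.1, localMatch z.1.1.1 z.1.2 z.2 S)))

theorem iterate_greedyOp (N : Network a n) (h : Fin n → Λ) (t : ℕ) :
    N.greedyOp^[t] (fun v => ((N.vid v, h v), none)) =
      fun v => ((N.vid v, h v), N.greedy t v) := by
  induction t with
  | zero => rfl
  | succ t ih =>
    unfold greedy
    simp only [Function.iterate_succ_apply', ih]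
    rfl

theorem implements_gossipStep (hq : 0 < q) {I α : Type} [Finite I]
    (hI : Nat.card (Option I) ≤ 2 ^ (b * q)) :
    Implements (a := a) (n := n) κ b q fun N (x : Fin n → α × Set I × Set I) v =>
      ((x v).1, N.gossipStep (fun u => (x u).2) v) :=
  Implements.exchange hq hI (fun x : α × Set I × Set I => nextItem x.2)
    (fun x S => (x.1, updateItems x.2 S))

theorem iterate_gossipStep (N : Network a n) {I α : Type} (y : Fin n → α) (K : Fin n → Set I)
    (t : ℕ) : (fun (x : Fin n → α × Set I × Set I) v =>
      ((x v).1, N.gossipStep (fun u => (x u).2) v))^[t] (fun v => (y v, K v, ∅)) =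
      fun v => (y v, N.gossip K t v) := by
  induction t with
  | zero => rfl
  | succ t ih =>
    unfold gossip
    simp only [Function.iterate_succ_apply', ih]
    rfl

/-- The exchanges are `2 * k` for the greedy matching, one for the codes, `6 * k` for the gossip and
one for the picks. All are given the length of an item, into which the other kinds of message embed.
-/
theorem computes_matchingOutput [Finite Λ] [Nonempty Λ] (hn : 0 < n) (hk : 0 < k) (hq : 0 < q)
    (hcard : Nat.card (Option (Item (Fin (n ^ a)) Λ k)) ≤ 2 ^ (b * q))
    (lab : Fin (n ^ a) → (Fin κ → Bool) → Λ) :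
    Computes κ b ((8 * k + 2) * q) fun (N : Network a n) ω v =>
      N.matchingOutput k (fun u => lab (N.vid u) (ω u)) v := by
  have l₀ : Λ := Classical.arbitrary Λ
  have i₀ : Fin (n ^ a) := ⟨0, pow_pos hn a⟩
  have hcode : Nat.card (Bool × Λ) ≤ 2 ^ (b * q) :=
    (Nat.card_le_card_of_injective
      (fun c => (some (i₀, l₀, fun _ => some c) : Option (Item (Fin (n ^ a)) Λ k)))
      fun c d e => by
        have := congrFun (congrArg (fun x => x.2.2) (Option.some.inj e)) ⟨0, by omega⟩
        exact Option.some.inj this).trans hcard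
  have hbool : Nat.card Bool ≤ 2 ^ (b * q) :=
    (Nat.card_le_card_of_injective (fun c => (c, l₀)) fun c d e => congrArg Prod.fst e).trans hcode
  have hid : Nat.card (Option (Fin (n ^ a))) ≤ 2 ^ (b * q) :=
    (Nat.card_le_card_of_injective
      (Option.map fun i => ((i, l₀, fun _ => none) : Item (Fin (n ^ a)) Λ k))
      (Option.map_injective fun c d e => congrArg Prod.fst e)).trans hcard
  have c1 : Computes (a := a) (n := n) κ b 0 fun N ω v =>
      ((N.vid v, lab (N.vid v) (ω v)), (none : Option (Fin (n ^ a)))) :=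
    computes_input hn fun i w => ((i, lab i w), none)
  have c2 := (implements_greedyOp hq hbool hid).iterate k _ _ c1
  simp only [iterate_greedyOp] at c2
  have c3 := c2.exchange hq hcode (fun x => (x.2.isSome, x.1.2))
    (fun x S => ((x, S), localItems k x.1.1 x.1.2 x.2 S, (∅ : Set (Item (Fin (n ^ a)) Λ k))))
  have c4 := (implements_gossipStep hq hcard).iterate (3 * (2 * k)) _ _ c3
  simp only [iterate_gossipStep] at c4
  have c5 := c4.exchange hq hid (fun x => localPick x.1.1.2 x.1.1.1.2 x.1.2 x.2.1)
    (fun x S => (localOutput x.1.1.1.1 x.1.1.2 x.2.1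
      (localPick x.1.1.2 x.1.1.1.2 x.1.2 x.2.1) S).map fun S => Fin.val '' S)
  have ht : 0 + k * (q + q) + q + 3 * (2 * k) * q + q = (8 * k + 2) * q := by ring
  rw [ht] at c5
  exact c5

end Network

/-- The bits pay for the identifier, the label, `2 * k` entries (a label, the matched flag and
possible absence), and silence. -/
theorem card_option_item_le {a n k b ℓ : ℕ} {Λ : Type} [Finite Λ] (hn : n ≤ 2 ^ b)
    (hΛ : Nat.card Λ ≤ 2 ^ ℓ) : Nat.card (Option (Item (Fin (n ^ a)) Λ k)) ≤
      2 ^ (a * b + ℓ + (ℓ + 2) * (2 * k) + 1) := by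
  have := Fintype.ofFinite Λ
  have h1 : n ^ a ≤ 2 ^ (a * b) := by
    rw [mul_comm, pow_mul]
    exact Nat.pow_le_pow_left hn a
  have h2 : 2 * Nat.card Λ + 1 ≤ 2 ^ (ℓ + 2) := by
    have := Nat.one_le_two_pow (n := ℓ)
    rw [pow_add]
    omega
  have h3 : n ^ a * (Nat.card Λ * (2 * Nat.card Λ + 1) ^ (2 * k)) ≤
      2 ^ (a * b + ℓ + (ℓ + 2) * (2 * k)) := by
    rw [pow_add, pow_add, pow_mul _ (ℓ + 2), mul_assoc]
    gcongr
  have h4 : Nat.card (Option (Item (Fin (n ^ a)) Λ k)) =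
      n ^ a * (Nat.card Λ * (2 * Nat.card Λ + 1) ^ (2 * k)) + 1 := by
    rw [Finite.card_option, Nat.card_prod, Nat.card_prod, Nat.card_fun, Finite.card_option,
      Nat.card_prod]
    simp
  rw [h4, pow_succ]
  have := Nat.one_le_two_pow (n := a * b + ℓ + (ℓ + 2) * (2 * k))
  omega

/-- The number of `b`-bit messages that suffice for an item with labels of `ℓ` bits. -/
def chunks (a b k ℓ : ℕ) : ℕ := (a * b + ℓ + (ℓ + 2) * (2 * k) + 1) / b + 1

theorem le_mul_chunks {a b k ℓ : ℕ} (hb : 0 < b) :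
    a * b + ℓ + (ℓ + 2) * (2 * k) + 1 ≤ b * chunks a b k ℓ :=
  (Nat.lt_mul_div_succ _ hb).le

theorem computes_const {a n κ b T : ℕ} {τ : Type} (c : τ) :
    Computes (a := a) (n := n) κ b T fun _ _ _ => c :=
  ⟨⟨Unit, fun _ => (), fun _ _ => [], fun _ _ _ => (), fun _ => c⟩,
    fun _ _ => ⟨fun _ _ _ => Nat.zero_le _, fun _ => rfl⟩⟩

/-- The matching algorithm with labels of at most `ℓ` bits, as a distributed algorithm. -/
theorem exists_matching_algorithm (a : ℕ) (κ ℓ : ℕ → ℕ → ℕ) (Λ : ℕ → ℕ → Type)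
    [∀ n k, Finite (Λ n k)] (hΛ : ∀ n k, 0 < n → Nat.card (Λ n k) ≤ 2 ^ ℓ n k)
    (lab : ∀ n k, Fin (n ^ a) → (Fin (κ n k) → Bool) → Λ n k) :
    ∃ P, (DistAlgorithm.ofPrograms κ (fun n k => if k = 0 then 0 else
        (8 * k + 2) * chunks a (Nat.log 2 n + 1) k (ℓ n k)) P).IsCongest a 2 ∧
      ∀ (n k : ℕ) (N : Network a n), ∃ W : Finset (Fin n), W.card ≤ 4 * k ∧
        ∀ ω : Fin n → Fin (κ n k) → Bool,
          Set.InjOn (fun v => lab n k (N.vid v) (ω v)) W →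
            N.IsKMaxMOutput k ((DistAlgorithm.ofPrograms κ (fun n k => if k = 0 then 0 else
              (8 * k + 2) * chunks a (Nat.log 2 n + 1) k (ℓ n k)) P).result N k ω) := by
  obtain ⟨P, hP, hres⟩ := DistAlgorithm.exists_ofPrograms a κ
    (fun n k => if k = 0 then 0 else (8 * k + 2) * chunks a (Nat.log 2 n + 1) k (ℓ n k))
    (fun n k N ω v => N.matchingOutput k (fun u => lab n k (N.vid u) (ω u)) v) (by
      intro n k
      rcases Nat.eq_zero_or_pos n with rfl | hn
      · have he : (fun (N : Network a 0) (ω : Fin 0 → Fin (κ 0 k) → Bool) v =>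
            N.matchingOutput k (fun u => lab 0 k (N.vid u) (ω u)) v) = fun _ _ _ => none :=
          funext fun _ => funext fun _ => funext fun v => v.elim0
        rw [he]
        exact computes_const none
      -- A bound proportional to `k ^ 2` allows no round for `k = 0`; the empty matching needs none.
      rcases Nat.eq_zero_or_pos k with rfl | hk
      · have he : (fun (N : Network a n) (ω : Fin n → Fin (κ n 0) → Bool) v =>
            N.matchingOutput 0 (fun u => lab n 0 (N.vid u) (ω u)) v) = fun _ _ _ => some ∅ := by
          funext N ω v
          simp [Network.matchingOutput, localOutput, Network.greedy]
        rw [he]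
        exact computes_const _
      · have : Nonempty (Λ n k) := ⟨lab n k ⟨0, pow_pos hn a⟩ fun _ => false⟩
        simp only [hk.ne', if_false]
        refine Network.computes_matchingOutput hn hk (Nat.succ_pos _) ?_ (lab n k)
        refine (card_option_item_le (Nat.lt_pow_succ_log_self one_lt_two n).le
          (hΛ n k hn)).trans (Nat.pow_le_pow_right two_pos ?_)
        exact le_mul_chunks (Nat.succ_pos _))
  refine ⟨P, hP, fun n k N => ?_⟩
  obtain ⟨W, hW, hcorrect⟩ := N.isKMaxMOutput_matchingOutput k
  refine ⟨W, hW, fun ω hinj => ?_⟩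
  rw [hres]
  exact hcorrect _ _ hinj

/-! ### Probability and numbers of rounds -/

/-- Independent uniform labels are distinct on a set `W` with high probability. -/
theorem one_sub_le_prob_injOn {V Λ : Type} [Finite V] [Finite Λ] [Nonempty Λ] (W : Finset V) :
    1 - (W.card : ℝ) ^ 2 / Nat.card Λ ≤
      ({ω : V → Λ | Set.InjOn ω W}.ncard : ℝ) / Nat.card (V → Λ) := by
  classical
  have := Fintype.ofFinite V
  have := Fintype.ofFinite Λ
  have hL : (0 : ℝ) < Nat.card Λ := by exact_mod_cast Nat.card_pos
  have hT : (0 : ℝ) < Nat.card (V → Λ) := by exact_mod_cast Nat.card_pos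
  -- Overwriting the label of `u` loses no information on a collision, because `v` still carries the
  -- old value.
  have hpair : ∀ u v : V, u ≠ v → {ω : V → Λ | ω u = ω v}.ncard * Nat.card Λ ≤
      Nat.card (V → Λ) := by
    intro u v huv
    rw [← Nat.card_coe_set_eq, ← Nat.card_prod]
    refine Nat.card_le_card_of_injective
      (fun p : {ω : V → Λ | ω u = ω v} × Λ => Function.update (p.1 : V → Λ) u p.2) ?_
    rintro ⟨⟨ω, hω⟩, x⟩ ⟨⟨ω', hω'⟩, x'⟩ e
    dsimp only at e
    have hx : x = x' := by simpa using congrFun e u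
    have hne : ∀ w, w ≠ u → ω w = ω' w := by
      intro w hw
      simpa [hw] using congrFun e w
    have hω'' : ω = ω' := by
      funext w
      by_cases hw : w = u
      · rw [hw]
        exact hω.trans ((hne v huv.symm).trans hω'.symm)
      · exact hne w hw
    subst hx hω''
    rfl
  have hcompl : {ω : V → Λ | Set.InjOn ω W}ᶜ ⊆
      ⋃ p ∈ W.offDiag, {ω : V → Λ | ω p.1 = ω p.2} := by
    intro ω hω
    simp only [Set.mem_compl_iff, Set.mem_ofPred_eq, Set.InjOn] at hω
    push Not at hω
    obtain ⟨u, hu, v, hv, he, hne⟩ := hω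
    simp only [Set.mem_iUnion]
    exact ⟨(u, v), Finset.mem_offDiag.2 ⟨hu, hv, hne⟩, he⟩
  have hbad : {ω : V → Λ | Set.InjOn ω W}ᶜ.ncard * Nat.card Λ ≤ W.card ^ 2 * Nat.card (V → Λ) :=
    calc _ ≤ (⋃ p ∈ W.offDiag, {ω : V → Λ | ω p.1 = ω p.2}).ncard * Nat.card Λ :=
          Nat.mul_le_mul_right _ (Set.ncard_le_ncard hcompl)
      _ ≤ (∑ p ∈ W.offDiag, {ω : V → Λ | ω p.1 = ω p.2}.ncard) * Nat.card Λ :=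
          Nat.mul_le_mul_right _ (Finset.set_ncard_biUnion_le _ _)
      _ = ∑ p ∈ W.offDiag, {ω : V → Λ | ω p.1 = ω p.2}.ncard * Nat.card Λ :=
          Finset.sum_mul _ _ _
      _ ≤ ∑ _p ∈ W.offDiag, Nat.card (V → Λ) :=
          Finset.sum_le_sum fun p hp => hpair _ _ (Finset.mem_offDiag.1 hp).2.2
      _ ≤ _ := by
          rw [Finset.sum_const, smul_eq_mul, Finset.offDiag_card, sq]
          exact Nat.mul_le_mul_right _ (Nat.sub_le _ _)
  have hsum := Set.ncard_add_ncard_compl {ω : V → Λ | Set.InjOn ω W}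
  have hsum' : ({ω : V → Λ | Set.InjOn ω W}.ncard : ℝ) +
      ({ω : V → Λ | Set.InjOn ω W}ᶜ.ncard : ℝ) = Nat.card (V → Λ) := by exact_mod_cast hsum
  have hbad' : ({ω : V → Λ | Set.InjOn ω W}ᶜ.ncard : ℝ) * Nat.card Λ ≤
      (W.card : ℝ) ^ 2 * Nat.card (V → Λ) := by exact_mod_cast hbad
  rw [le_div_iff₀ hT, sub_mul, one_mul, div_mul_eq_mul_div, sub_le_comm, le_div_iff₀ hL]
  rwa [← hsum', add_sub_cancel_left, hsum']

theorem chunks_le_of_identifiers {a b k : ℕ} (hb : 0 < b) (hk : 0 < k) :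
    chunks a b k (a * b) ≤ (4 * a + 6) * k := by
  unfold chunks
  have h : (a * b + a * b + (a * b + 2) * (2 * k) + 1) / b ≤ 2 * a + (a + 2) * (2 * k) + 1 := by
    apply Nat.div_le_of_le_mul
    nlinarith [Nat.mul_le_mul_right k hb]
  nlinarith

theorem chunks_le_of_random {a n k s : ℕ} (hn : 2 ≤ n) (hk : 1 ≤ k) :
    (chunks a (Nat.log 2 n + 1) k (s * (Nat.log 2 k + 1)) : ℝ) * k ≤
      (a + 6 * s + 12) * (k + (k : ℝ) ^ 2 * Real.log k / Real.log n) := by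
  set b := Nat.log 2 n + 1 with hb
  set l := Nat.log 2 k + 1 with hl
  have hk' : (1 : ℝ) ≤ k := by exact_mod_cast hk
  have hlogn : 0 < Real.log n := Real.log_pos (by exact_mod_cast hn)
  have hlogk : 0 ≤ Real.log k := Real.log_nonneg hk'
  have hlog2 : 0 < Real.log 2 := Real.log_pos one_lt_two
  have hb1 : (1 : ℝ) ≤ b := by exact_mod_cast Nat.succ_pos _
  have hl1 : (1 : ℝ) ≤ l := by exact_mod_cast Nat.succ_pos _
  have hbn : Real.log n ≤ b * Real.log 2 := by
    rw [← Real.log_pow]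
    refine Real.log_le_log (by positivity) ?_
    exact_mod_cast (Nat.lt_pow_succ_log_self one_lt_two n).le
  have hlk : (l : ℝ) * Real.log 2 ≤ Real.log k + Real.log 2 := by
    have : (Nat.log 2 k : ℝ) * Real.log 2 ≤ Real.log k := by
      rw [← Real.log_pow]
      refine Real.log_le_log (by positivity) ?_
      exact_mod_cast Nat.pow_log_le_self 2 (by omega)
    rw [hl]
    push_cast
    linarith
  have hratio : (l : ℝ) / b * k ≤ 2 * (1 + k * Real.log k / Real.log n) := by
    -- For `k = 1` the logarithm vanishes but a label still has bits; the summand 1 absorbs them.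
    rcases hk.eq_or_lt with h | h
    · have : l = 1 := by rw [hl, ← h]; simp
      rw [this, ← h]
      simp only [Nat.cast_one, Real.log_one, mul_zero, zero_div, mul_one]
      rw [div_le_iff₀ (by linarith)]
      linarith
    · have h2k : Real.log 2 ≤ Real.log k :=
        Real.log_le_log two_pos (by exact_mod_cast h)
      have h1 : (l : ℝ) / b ≤ 2 * Real.log k / Real.log n := by
        rw [div_le_div_iff₀ (by linarith) hlogn]
        calc (l : ℝ) * Real.log n ≤ l * (b * Real.log 2) := by gcongr
          _ = (l * Real.log 2) * b := by ring
          _ ≤ 2 * Real.log k * b :=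
            mul_le_mul_of_nonneg_right (by linarith) (by linarith)
      calc (l : ℝ) / b * k ≤ 2 * Real.log k / Real.log n * k := by gcongr
        _ ≤ 2 * (1 + k * Real.log k / Real.log n) := by
          have : 2 * Real.log k / Real.log n * k = 2 * (k * Real.log k / Real.log n) := by ring
          linarith
  have hc : (chunks a b k (s * l) : ℝ) ≤ a + 1 + (3 * s + 5) * (l / b * k) := by
    have h1 : (chunks a b k (s * l) : ℝ) ≤
        ((a * b + s * l + (s * l + 2) * (2 * k) + 1 : ℕ) : ℝ) / b + 1 := by
      unfold chunks
      push_cast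
      have := @Nat.cast_div_le ℝ _ _ _ (a * b + s * l + (s * l + 2) * (2 * k) + 1) b
      push_cast at this
      linarith
    have h2 : ((a * b + s * l + (s * l + 2) * (2 * k) + 1 : ℕ) : ℝ) ≤
        a * b + (3 * s + 5) * (l * k) := by
      have : a * b + s * l + (s * l + 2) * (2 * k) + 1 ≤ a * b + (3 * s + 5) * (l * k) := by
        have hk1 : s * l ≤ s * l * k := Nat.le_mul_of_pos_right _ hk
        have hlk1 : k ≤ l * k := Nat.le_mul_of_pos_left _ (Nat.succ_pos _)
        nlinarith
      exact_mod_cast this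
    calc (chunks a b k (s * l) : ℝ) ≤ (a * b + (3 * s + 5) * (l * k)) / b + 1 := by
          refine h1.trans ?_
          gcongr
      _ = a + 1 + (3 * s + 5) * (l / b * k) := by
          field_simp
          ring
  have hx : 0 ≤ k * Real.log k / Real.log n := by positivity
  have hc' : (chunks a b k (s * l) : ℝ) ≤
      (a + 6 * s + 12) * (1 + k * Real.log k / Real.log n) := by
    have h1 : (3 * s + 5 : ℝ) * (l / b * k) ≤
        (3 * s + 5) * (2 * (1 + k * Real.log k / Real.log n)) := by gcongr
    have ha : (0 : ℝ) ≤ a := by positivity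
    nlinarith [mul_nonneg ha hx]
  calc _ ≤ (a + 6 * s + 12) * (1 + k * Real.log k / Real.log n) * k := by gcongr
    _ = _ := by ring

/-! ### Choice of labels and constants -/

theorem mainTheorem6 (a : ℕ) :
    ∃ B : ℝ,
      (∃ (A : DistAlgorithm) (C : ℝ), A.IsDeterministic ∧ A.IsCongest a B ∧
        (∀ n k : ℕ, (A.rounds n k : ℝ) ≤ C * (k : ℝ) ^ 2) ∧
        ∀ (n : ℕ) (N : Network a n) (k : ℕ) (ω : A.Coins n k),
          N.IsKMaxMOutput k (A.result N k ω)) ∧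
      (∀ c : ℕ, ∃ (A : DistAlgorithm) (C : ℝ), A.IsCongest a B ∧
        (∀ n k : ℕ, 2 ≤ n → 1 ≤ k →
          (A.rounds n k : ℝ) ≤ C * (k + (k : ℝ) ^ 2 * Real.log k / Real.log n)) ∧
        ∀ (n : ℕ) (N : Network a n) (k : ℕ), 1 ≤ k →
          1 - 1 / (k : ℝ) ^ c ≤ A.prob n k {ω | N.IsKMaxMOutput k (A.result N k ω)}) := by
  refine ⟨2, ?_, fun c => ?_⟩
  · obtain ⟨P, hP, hcorrect⟩ := exists_matching_algorithm a (fun _ _ => 0)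
      (fun n _ => a * (Nat.log 2 n + 1)) (fun n _ => Fin (n ^ a)) (fun n k _ => by
        rw [Nat.card_fin, mul_comm, pow_mul]
        exact Nat.pow_le_pow_left (Nat.lt_pow_succ_log_self one_lt_two n).le a) (fun _ _ i _ => i)
    refine ⟨_, 10 * (4 * a + 6), fun _ _ => rfl, hP, fun n k => ?_, fun n N k ω => ?_⟩
    · change ((if k = 0 then 0 else _ : ℕ) : ℝ) ≤ _
      split_ifs with hk
      · simp [hk]
      · have hk' := Nat.pos_of_ne_zero hk
        have h := chunks_le_of_identifiers (a := a) (Nat.succ_pos (Nat.log 2 n)) hk'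
        have h' : (8 * k + 2) * chunks a (Nat.log 2 n + 1) k (a * (Nat.log 2 n + 1)) ≤
            10 * k * ((4 * a + 6) * k) := Nat.mul_le_mul (by omega) h
        calc _ ≤ ((10 * k * ((4 * a + 6) * k) : ℕ) : ℝ) := by exact_mod_cast h'
          _ = _ := by push_cast; ring
    · obtain ⟨W, -, hW⟩ := hcorrect n k N
      exact hW ω N.vid_injective.injOn
  -- Of the factor `c + 6`, the part `c + 2` gives `k ^ (c + 2)` labels and the part 4 gives the
  -- factor 16. Together they beat the at most `(4 * k) ^ 2` pairs by `k ^ c`.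
  · obtain ⟨P, hP, hcorrect⟩ := exists_matching_algorithm a
      (fun _ k => (c + 6) * (Nat.log 2 k + 1)) (fun _ k => (c + 6) * (Nat.log 2 k + 1))
      (fun _ k => Fin ((c + 6) * (Nat.log 2 k + 1)) → Bool) (fun n k _ => by simp)
      (fun _ _ _ w => w)
    refine ⟨_, 10 * (a + 6 * (c + 6 : ℕ) + 12), hP, fun n k hn hk => ?_, fun n N k hk => ?_⟩
    · change ((if k = 0 then 0 else _ : ℕ) : ℝ) ≤ _
      rw [if_neg (by omega)]
      have h := chunks_le_of_random (a := a) (s := c + 6) hn hk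
      have hk' : (1 : ℝ) ≤ k := by exact_mod_cast hk
      rw [mul_assoc 10]
      refine le_trans ?_ (mul_le_mul_of_nonneg_left h (by norm_num))
      push_cast
      set q : ℝ := (chunks a (Nat.log 2 n + 1) k ((c + 6) * (Nat.log 2 k + 1)) : ℝ)
      have hq : 0 ≤ q := Nat.cast_nonneg _
      nlinarith
    · obtain ⟨W, hW, hWc⟩ := hcorrect n k N
      have hk' : (0 : ℝ) < k := by exact_mod_cast hk
      have hL : 16 * (k : ℝ) ^ (c + 2) ≤
          Nat.card (Fin ((c + 6) * (Nat.log 2 k + 1)) → Bool) := by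
        have h1 : k ≤ 2 ^ (Nat.log 2 k + 1) := (Nat.lt_pow_succ_log_self one_lt_two k).le
        have h2 : 2 ≤ 2 ^ (Nat.log 2 k + 1) := Nat.le_self_pow (Nat.succ_ne_zero _) 2
        have : 16 * k ^ (c + 2) ≤ 2 ^ ((c + 6) * (Nat.log 2 k + 1)) :=
          calc 16 * k ^ (c + 2) = 2 ^ 4 * k ^ (c + 2) := by norm_num
            _ ≤ (2 ^ (Nat.log 2 k + 1)) ^ 4 * (2 ^ (Nat.log 2 k + 1)) ^ (c + 2) :=
              Nat.mul_le_mul (Nat.pow_le_pow_left h2 4) (Nat.pow_le_pow_left h1 _)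
            _ = _ := by rw [← pow_add, ← pow_mul]; congr 1; ring
        simpa using (by exact_mod_cast this : ((16 * k ^ (c + 2) : ℕ) : ℝ) ≤ _)
      have hprob := one_sub_le_prob_injOn (Λ := Fin ((c + 6) * (Nat.log 2 k + 1)) → Bool) W
      have hWk : (W.card : ℝ) ≤ 4 * k := by exact_mod_cast hW
      refine le_trans ?_ (hprob.trans ?_)
      · have : (W.card : ℝ) ^ 2 / Nat.card (Fin ((c + 6) * (Nat.log 2 k + 1)) → Bool) ≤
            1 / (k : ℝ) ^ c :=
          calc _ ≤ (4 * (k : ℝ)) ^ 2 / (16 * (k : ℝ) ^ (c + 2)) := by gcongr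
            _ = _ := by field_simp; ring
        linarith
      · unfold DistAlgorithm.prob
        refine div_le_div_of_nonneg_right ?_ (Nat.cast_nonneg _)
        exact_mod_cast Set.ncard_le_ncard (s := {ω : Fin n → _ | Set.InjOn ω W})
          (fun ω hω => hWc ω hω) (Set.toFinite _)
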